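/- Let $D$ be a Dedekind domain with field of fractions $K$ such that $D/I$ is finite for every nonzero ideal $I$. Let $A$ be a (not necessarily commutative) unital $D$-algebra which is finitely generated and torsion-free as a $D$-module. Put $B = K\otimes_D A$, regard $K$ and $A$ as embedded in $B$ via $k\mapsto k\otimes 1$ and $a\mapsto 1\otimes a$, and assume $A\cap K = D$. For $f=\sum_i c_iX^i\in B[X]$ (where $X$ commutes with $B$) and $b\in B$ put $f(b)=\sum_i c_i b^i$, and let $$\mathrm{Int}(A)=\{f\in B[X] : f(A)\subseteq A\},\qquad \mathrm{Int}_K(A)=\mathrm{Int}(A)\cap K[X].$$ Call $A$ \emph{$\mathrm{Int}_K$-decomposable} if the $D$-linear map $\Phi:\mathrm{Int}_K(A)\otimes_D A\to \mathrm{Int}(A)$, $f\otimes a\mapsto f\cdot a$, is an isomorphism. For a nonzero prime $P$ of $D$ let $\widehat D_P=\varprojlim D/P^k$, let $\widehat K_P$ be its fraction field, and let $\widehat A_P=\varprojlim A/P^kA$, which is a $\widehat D_P$-algebra. Then $A$ is $\mathrm{Int}_K$-decomposable if and only if for each nonzero prime ideal $P$ of $D$ there exist integers $n,t\ge 1$ and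 a complete discrete valuation ring $\widehat T_P\supseteq \widehat D_P$ with finite residue field, whose fraction field is a finite unramified extension of $\widehat K_P$ (unramified means that $P\widehat T_P$ is the maximal ideal of $\widehat T_P$), such that $$\widehat A_P\cong\bigoplus_{i=1}^t M_n(\widehat T_P)$$ as $\widehat D_P$-algebras. In particular, if $A$ is commutative, then $A$ is $\mathrm{Int}_K$-decomposable if and only if for each nonzero prime ideal $P$ of $D$ there exist an integer $t\ge 1$ and $\widehat T_P$ as above such that $\widehat A_P\cong\bigoplus_{i=1}^t\widehat T_P$ as $\widehat D_P$-algebras. -/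

import Mathlib

open scoped TensorProduct Polynomial

universe u v w

namespace IntDecomp

noncomputable section

section IntegerValued

variable (D : Type u) [CommRing D] (K : Type w) [Field K] [Algebra D K]
  (A : Type v) [Ring A] [Algebra D A]

/-- The extended algebra `B = K ⊗_D A`. -/
abbrev Ext : Type (max v w) := K ⊗[D] A

/-- The canonical map `A → B`, `a ↦ 1 ⊗ a`. -/
abbrev ofA : A →ₐ[D] Ext D K A := Algebra.TensorProduct.includeRight

/-- Standard assumptions: `A` is torsion-free over `D` and `A ∩ K = D`
(inside `B = K ⊗_D A`, with `K` embedded by `k ↦ k ⊗ 1` and `A` by `a ↦ 1 ⊗ a`). -/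
structure StandardAssumptions : Prop where
  torsionFree : Module.IsTorsionFree D A
  inter_eq : ∀ k : K, (∃ a : A, (k ⊗ₜ[D] (1 : A) : Ext D K A) = ofA D K A a) ↔
    ∃ d : D, k = algebraMap D K d

/-- `Int(A) = {f ∈ B[X] | f(A) ⊆ A}`, as a `D`-submodule of `B[X]`. Here `Polynomial.eval b f` is
`∑ cᵢ bⁱ`, with the coefficients on the left. -/
def IntA : Submodule D (Ext D K A)[X] where
  carrier := {f | ∀ a : A, ∃ a' : A, f.eval (ofA D K A a) = ofA D K A a'}
  zero_mem' a := ⟨0, by simp⟩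
  add_mem' {f g} hf hg a := by
    obtain ⟨x, hx⟩ := hf a
    obtain ⟨y, hy⟩ := hg a
    exact ⟨x + y, by rw [Polynomial.eval_add, hx, hy, map_add]⟩
  smul_mem' d f hf a := by
    obtain ⟨x, hx⟩ := hf a
    exact ⟨d • x, by rw [Polynomial.eval_smul, hx, map_smul]⟩

/-- The inclusion `K[X] → B[X]`. -/
abbrev coeffMap : K[X] →ₐ[D] (Ext D K A)[X] :=
  Polynomial.mapAlgHom (Algebra.TensorProduct.includeLeft : K →ₐ[D] Ext D K A)

/-- `Int_K(A) = Int(A) ∩ K[X] = {f ∈ K[X] | f(A) ⊆ A}`, as a `D`-submodule of `K[X]`. -/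
def IntK : Submodule D K[X] := (IntA D K A).comap (coeffMap D K A).toLinearMap

variable {D K A}

theorem coeffMap_mul_C_comm (f : K[X]) (b : A) :
    coeffMap D K A f * Polynomial.C (ofA D K A b) =
      Polynomial.C (ofA D K A b) * coeffMap D K A f := by
  ext n
  simp [Polynomial.coeff_map]

theorem coeffMap_mul_C_mem {f : K[X]} (hf : f ∈ IntK D K A) (b : A) :
    coeffMap D K A f * Polynomial.C (ofA D K A b) ∈ IntA D K A := by
  intro a
  obtain ⟨x, hx⟩ := hf a
  refine ⟨b * x, ?_⟩
  rw [coeffMap_mul_C_comm, Polynomial.eval_C_mul, map_mul]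
  exact congrArg _ hx

variable (D K A)

/-- The `D`-linear map `Φ : Int_K(A) ⊗_D A → Int(A)` with `Φ (f ⊗ a) = f · a`. -/
def Phi : IntK D K A ⊗[D] A →ₗ[D] IntA D K A :=
  TensorProduct.lift <| LinearMap.mk₂ D
    (fun f b => ⟨coeffMap D K A f * Polynomial.C (ofA D K A b), coeffMap_mul_C_mem f.2 b⟩)
    (fun f g b => Subtype.ext (by simp [add_mul]))
    (fun d f b => Subtype.ext (by simp only [Submodule.coe_smul, map_smul, smul_mul_assoc]))
    (fun f a b => Subtype.ext (by simp only [map_add, mul_add, Submodule.coe_add]))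
    (fun d f b => Subtype.ext (by
      simp only [Submodule.coe_smul, map_smul, ← mul_smul_comm, Polynomial.smul_C]))

/-- `A` is `Int_K`-decomposable if `Φ : Int_K(A) ⊗_D A → Int(A)` is an isomorphism. -/
def IsIntKDecomposable : Prop := Function.Bijective (Phi D K A)

end IntegerValued

section Completion

variable {D : Type u} [CommRing D] (P : Ideal D) (A : Type v) [Ring A] [Algebra D A]

/-- The two-sided ideal `P^k A` of `A`. -/
abbrev powIdeal (k : ℕ) : Ideal A := (P ^ k).map (algebraMap D A)

instance powIdeal_isTwoSided (k : ℕ) : (powIdeal P A k).IsTwoSided where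
  mul_mem_of_left {a} b ha := by
    refine Submodule.span_induction (p := fun x _ => x * b ∈ powIdeal P A k) ?_ ?_ ?_ ?_ ha
    · rintro _ ⟨d, hd, rfl⟩
      rw [Algebra.commutes]
      exact Ideal.mul_mem_left _ _ (Ideal.mem_map_of_mem _ hd)
    · simp
    · intro x y _ _ hx hy
      rw [add_mul]
      exact add_mem hx hy
    · intro c x _ hx
      rw [smul_eq_mul, mul_assoc]
      exact Ideal.mul_mem_left _ _ hx

theorem powIdeal_antitone {m n : ℕ} (h : m ≤ n) : powIdeal P A n ≤ powIdeal P A m :=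
  Ideal.map_mono (Ideal.pow_le_pow_right h)

/-- The ring `∏ₖ A / P^k A`. -/
abbrev QuotProd : Type v := ∀ k : ℕ, A ⧸ powIdeal P A k

/-- The subring of coherent sequences in `∏ₖ A / P^k A`. -/
def complSubring : Subring (QuotProd P A) where
  carrier := {x | ∀ (m n : ℕ) (h : m ≤ n), Ideal.Quotient.factor (powIdeal_antitone P A h) (x n) =
    x m}
  mul_mem' {x y} hx hy m n h := by simp [hx m n h, hy m n h]
  one_mem' m n h := by simp
  add_mem' {x y} hx hy m n h := by simp [hx m n h, hy m n h]
  zero_mem' m n h := by simp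
  neg_mem' {x} hx m n h := by simp [hx m n h]

/-- The `P`-adic completion `Â_P = lim A / P^k A`, as a ring. -/
def Compl : Type v := complSubring P A

instance : Ring (Compl P A) := inferInstanceAs (Ring (complSubring P A))

/-- The map `D / P^k → A / P^k A`. -/
def quotMap (k : ℕ) : D ⧸ P ^ k →+* A ⧸ powIdeal P A k :=
  Ideal.Quotient.lift (P ^ k) ((Ideal.Quotient.mk (powIdeal P A k)).comp (algebraMap D A))
    fun _ hd => Ideal.Quotient.eq_zero_iff_mem.2 (Ideal.mem_map_of_mem _ hd)

theorem quotMap_commutes (k : ℕ) (d : D ⧸ P ^ k) (x : A ⧸ powIdeal P A k) :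
    quotMap P A k d * x = x * quotMap P A k d := by
  obtain ⟨d, rfl⟩ := Ideal.Quotient.mk_surjective d
  obtain ⟨a, rfl⟩ := Ideal.Quotient.mk_surjective x
  simp only [quotMap, Ideal.Quotient.lift_mk, RingHom.comp_apply, ← map_mul, Algebra.commutes]

theorem factor_quotMap {m n : ℕ} (h : m ≤ n) (d : D ⧸ P ^ n) :
    Ideal.Quotient.factor (powIdeal_antitone P A h) (quotMap P A n d) =
      quotMap P A m (Ideal.Quotient.factor (Ideal.pow_le_pow_right h) d) := by
  obtain ⟨d, rfl⟩ := Ideal.Quotient.mk_surjective d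
  simp only [quotMap, Ideal.Quotient.lift_mk, RingHom.comp_apply, Ideal.Quotient.factor_mk]

/-- The map `D̂_P → Â_P` induced by the maps `D / P^k → A / P^k A`. -/
def complMap : AdicCompletion P D →+* Compl P A :=
  RingHom.codRestrict
    (RingHom.pi fun k => (quotMap P A k).comp (AdicCompletion.evalₐ P k).toRingHom)
    (complSubring P A) (fun x m n h => by
      obtain ⟨x, rfl⟩ := AdicCompletion.mk_surjective P D x
      refine (factor_quotMap P A h (AdicCompletion.evalₐ P n (AdicCompletion.mk P D x))).trans
        (congrArg (quotMap P A m)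
          (a₂ := AdicCompletion.evalₐ P m (AdicCompletion.mk P D x)) ?_)
      rw [AdicCompletion.evalₐ_mk, AdicCompletion.evalₐ_mk, Ideal.Quotient.factor_mk]
      exact AdicCompletion.Ideal.mk_eq_mk P h x)

instance : Algebra (AdicCompletion P D) (Compl P A) :=
  (complMap P A).toAlgebra' fun c x => Subtype.ext <| funext fun k =>
    quotMap_commutes P A k (AdicCompletion.evalₐ P k c) (x.1 k)

end Completion

section Unramified

variable {D : Type u} [CommRing D] (P : Ideal D)

/-- For a complete discrete valuation ring `T` over `D̂_P`: `T` has finite residue field, contains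
`D̂_P`, and `Frac T` is a finite unramified extension of `K̂_P = Frac D̂_P`, i.e. `P̂ T` is the maximal
ideal of `T` (the residue field extension is separable, as the residue fields are finite). -/
structure IsCompleteUnramified (T : Type u) [CommRing T] [IsDomain T] [IsDiscreteValuationRing T]
    [Algebra (AdicCompletion P D) T] : Prop where
  complete : IsAdicComplete (IsLocalRing.maximalIdeal T) T
  finite_residueField : Finite (IsLocalRing.ResidueField T)
  injective : Function.Injective (algebraMap (AdicCompletion P D) T)
  finite_fractionField : (IsFractionRing.map injective :
    FractionRing (AdicCompletion P D) →+* FractionRing T).Finite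
  unramified : (P.map (algebraMap D (AdicCompletion P D))).map (algebraMap (AdicCompletion P D) T) =
    IsLocalRing.maximalIdeal T

end Unramified

end

end IntDecomp

/-! The problem is local at a maximal ideal P, and the finite ring A/PA links polynomials to
structure. Fix π ∈ P, s ∉ P with sP ⊆ (π).

Suppose A is Int_K-decomposable. If ψ ∈ ℤ[X], c ∉ PA and cψ vanishes on A/PA, then (s/π)cψ lies in
Int(A). Decomposing it and applying to its coefficients a functional l : A → D with l(c) ∉ P puts
l(c)(s/π)ψ in Int_K(A), so ψ vanishes on A/PA (`hasNullTransfer_of_isIntKDecomposable`). A finite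
ring with this transfer property is rigid. Its radical is zero (`eq_bot_of_hasNullTransfer`):
otherwise X^(d+N) - X^d, null on a suitable simple factor M_d(F) of the semisimple quotient, is null
on the whole ring, which is refuted by perturbing a lift of a Jordan block by elements that
annihilate the radical. So A/PA is a product of matrix rings over finite fields, and moving null
polynomials between the factors forces equal sizes and equal fields. Finally the structure lifts:
there is an unramified T over D̂_P with residue field F (`exists_isModel`), M_n(T)^t is separable,
and a homomorphism from a separable algebra lifts through powers of π because the obstructing
Hochschild cocycle is a coboundary modulo π (`exists_better_lift`). Hence Â_P ≅ M_n(T)^t.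

Conversely, let Â_P ≅ M_n(T)^t. A polynomial that is null modulo π^k stays null when its
coefficients are multiplied on the right by matrix units (`IsNullSeq.mul_single`). This isolates
entries in T. Automorphisms σ_i of T with (σ_i b_j) invertible then isolate coordinates in D̂_P
(`sum_repr_smul_pow_mem`). So null polynomials modulo P^k come from polynomials over D, and for f ∈
Int(A) the ideal of r with rf in the image of Φ lies in no maximal ideal. Injectivity of Φ is
flatness of A. -/

namespace IntDecomp

/-! ### π-adic completeness and lifting of homomorphisms from separable algebras -/

section PiAdic

variable {R : Type*} [CommRing R]

/-- The submodule `π ^ k M` of `M`. -/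
def powSub (π : R) (k : ℕ) (M : Type*) [AddCommGroup M] [Module R M] : Submodule R M :=
  LinearMap.range (LinearMap.lsmul R M (π ^ k))

section Module

variable {π : R} {M N : Type*} [AddCommGroup M] [Module R M] [AddCommGroup N] [Module R N]

theorem mem_powSub {k : ℕ} {x : M} : x ∈ powSub π k M ↔ ∃ y, π ^ k • y = x := Iff.rfl

theorem mem_powSub_one {x : M} : x ∈ powSub π 1 M ↔ ∃ y, π • y = x := by
  simp [mem_powSub]

theorem smul_mem_powSub (k : ℕ) (x : M) : π ^ k • x ∈ powSub π k M := ⟨x, rfl⟩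

theorem smul_mem_powSub_one (x : M) : π • x ∈ powSub π 1 M := mem_powSub_one.2 ⟨x, rfl⟩

theorem powSub_zero : powSub π 0 M = ⊤ :=
  eq_top_iff.2 fun x _ => ⟨x, by simp⟩

theorem powSub_antitone {j k : ℕ} (h : j ≤ k) : powSub π k M ≤ powSub π j M := by
  rintro _ ⟨y, rfl⟩
  exact ⟨π ^ (k - j) • y, by simp [smul_smul, ← pow_add, Nat.sub_add_cancel h]⟩

theorem smul_mem_powSub_add {j k : ℕ} {x : M} (hx : x ∈ powSub π k M) :
    π ^ j • x ∈ powSub π (j + k) M := by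
  obtain ⟨y, rfl⟩ := hx
  exact ⟨y, by simp [smul_smul, pow_add]⟩

theorem map_mem_powSub (f : M →ₗ[R] N) {k : ℕ} {x : M} (hx : x ∈ powSub π k M) :
    f x ∈ powSub π k N := by
  obtain ⟨y, rfl⟩ := hx
  exact ⟨f y, by simp⟩

theorem mem_powSub_pi {ι : Type*} {M : ι → Type*} [∀ i, AddCommGroup (M i)] [∀ i, Module R (M i)]
    {k : ℕ} {x : ∀ i, M i} : x ∈ powSub π k (∀ i, M i) ↔ ∀ i, x i ∈ powSub π k (M i) := by
  constructor
  · rintro ⟨y, rfl⟩ i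
    exact ⟨y i, rfl⟩
  · intro h
    choose y hy using h
    exact ⟨y, funext hy⟩

variable (π M) in
/-- `M` has no `π`-torsion. -/
def NoTorsion : Prop := ∀ x : M, π • x = 0 → x = 0

theorem NoTorsion.pow (h : NoTorsion π M) {k : ℕ} {x : M} (hx : π ^ k • x = 0) : x = 0 := by
  induction k generalizing x with
  | zero => simpa using hx
  | succ k ih => exact h _ (ih (by rwa [smul_smul, ← pow_succ]))

theorem NoTorsion.pow_cancel (h : NoTorsion π M) {k : ℕ} {x y : M}
    (hxy : π ^ k • x = π ^ k • y) : x = y :=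
  sub_eq_zero.1 (h.pow (k := k) (by rw [smul_sub, hxy, sub_self]))

theorem NoTorsion.pi {ι : Type*} {M : ι → Type*} [∀ i, AddCommGroup (M i)] [∀ i, Module R (M i)]
    (h : ∀ i, NoTorsion π (M i)) : NoTorsion π (∀ i, M i) :=
  fun _ hx => funext fun i => h i _ (congrFun hx i)

theorem NoTorsion.of_injective (f : M →ₗ[R] N) (hf : Function.Injective f) (h : NoTorsion π N) :
    NoTorsion π M := fun x hx => hf (by rw [map_zero, h (f x) (by rw [← map_smul, hx, map_zero])])

variable (π M) in
/-- `M` is separated and complete in the `π`-adic topology. -/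
structure PiComplete : Prop where
  haus : ∀ x : M, (∀ k, x ∈ powSub π k M) → x = 0
  prec : ∀ x : ℕ → M, (∀ k, x (k + 1) - x k ∈ powSub π k M) →
    ∃ l, ∀ k, l - x k ∈ powSub π k M

theorem PiComplete.pi {ι : Type*} {M : ι → Type*} [∀ i, AddCommGroup (M i)] [∀ i, Module R (M i)]
    (h : ∀ i, PiComplete π (M i)) : PiComplete π (∀ i, M i) where
  haus x hx := funext fun i => (h i).haus _ fun k => mem_powSub_pi.1 (hx k) i
  prec x hx := by
    choose l hl using fun i => (h i).prec (fun k => x k i) fun k => mem_powSub_pi.1 (hx k) i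
    exact ⟨l, fun k => mem_powSub_pi.2 fun i => hl i k⟩

theorem PiComplete.congr (h : PiComplete π M) (e : M ≃ₗ[R] N) : PiComplete π N where
  haus x hx := e.symm.injective (by
    rw [map_zero]
    exact h.haus _ fun k => map_mem_powSub e.symm.toLinearMap (hx k))
  prec x hx := by
    obtain ⟨l, hl⟩ := h.prec (fun k => e.symm (x k)) fun k => by
      simpa using map_mem_powSub e.symm.toLinearMap (hx k)
    exact ⟨e l, fun k => by simpa using map_mem_powSub e.toLinearMap (hl k)⟩

/-- A linear map between complete modules that is bijective modulo `π` is bijective. -/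
theorem bijective_of_bijective_mod (hM : PiComplete π M) (hN : PiComplete π N)
    (hN' : NoTorsion π N) (f : M →ₗ[R] N) (hs : ∀ y, ∃ x, y - f x ∈ powSub π 1 N)
    (hi : ∀ x, f x ∈ powSub π 1 N → x ∈ powSub π 1 M) : Function.Bijective f := by
  constructor
  · rw [injective_iff_map_eq_zero]
    intro x hx
    refine hM.haus x fun k => ?_
    induction k with
    | zero => simp [powSub_zero]
    | succ k ih =>
      obtain ⟨y, rfl⟩ := ih
      have h0 : f y = 0 := hN'.pow (k := k) (by simpa using hx)
      have := hi y (by rw [h0]; exact zero_mem _)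
      exact smul_mem_powSub_add this
  · intro y
    -- Successive approximation: the error π^k z is reduced by solving for z modulo π.
    have step : ∀ k (x : M), y - f x ∈ powSub π k N →
        ∃ x', x' - x ∈ powSub π k M ∧ y - f x' ∈ powSub π (k + 1) N := by
      rintro k x ⟨z, hz⟩
      obtain ⟨w, hw⟩ := hs z
      refine ⟨x + π ^ k • w, ⟨w, by simp⟩, ?_⟩
      have : y - f (x + π ^ k • w) = π ^ k • (z - f w) := by
        rw [map_add, map_smul, smul_sub, ← sub_sub, ← hz]; simp
      rw [this]
      exact smul_mem_powSub_add hw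
    choose! g hg1 hg2 using step
    let s : ℕ → M := fun k => Nat.rec 0 (fun k x => g k x) k
    have hs0 : ∀ k, y - f (s k) ∈ powSub π k N := by
      intro k
      induction k with
      | zero => simp [powSub_zero]
      | succ k ih => exact hg2 k _ ih
    obtain ⟨l, hl⟩ := hM.prec s fun k => hg1 k _ (hs0 k)
    refine ⟨l, ?_⟩
    rw [← sub_eq_zero]
    refine hN.haus _ fun k => ?_
    have h1 := map_mem_powSub f (hl k)
    rw [map_sub] at h1
    have := sub_mem h1 (hs0 k)
    simpa using this

end Module

section Algebra

variable {π : R} {C : Type*} [Ring C] [Algebra R C]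

theorem mul_mem_powSub_left {k : ℕ} (a : C) {x : C} (hx : x ∈ powSub π k C) :
    a * x ∈ powSub π k C := by
  obtain ⟨y, rfl⟩ := hx
  exact ⟨a * y, by simp⟩

theorem mul_mem_powSub_right {k : ℕ} {x : C} (hx : x ∈ powSub π k C) (a : C) :
    x * a ∈ powSub π k C := by
  obtain ⟨y, rfl⟩ := hx
  exact ⟨y * a, by simp⟩

theorem mul_sub_mul_mem_powSub {k : ℕ} {x x' y y' : C} (hx : x - x' ∈ powSub π k C)
    (hy : y - y' ∈ powSub π k C) : x * y - x' * y' ∈ powSub π k C := by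
  have : x * y - x' * y' = (x - x') * y + x' * (y - y') := by noncomm_ring
  rw [this]
  exact add_mem (mul_mem_powSub_right hx _) (mul_mem_powSub_left _ hy)

variable {E : Type*} [Ring E] [Algebra R E] {ι : Type*} [Fintype ι]

/-- The elements `a i ⊗ b i` sum up to a separability idempotent of `E`. -/
structure IsSeparability (R : Type*) [CommRing R] {E : Type*} [Ring E] [Algebra R E]
    {ι : Type*} [Fintype ι] (a b : ι → E) : Prop where
  sum_mul : ∑ i, a i * b i = 1
  comm : ∀ y, ∑ i, (y * a i) ⊗ₜ[R] b i = ∑ i, a i ⊗ₜ[R] (b i * y)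

theorem IsSeparability.bilin {a b : ι → E} (h : IsSeparability R a b) {M : Type*} [AddCommGroup M]
    [Module R M] (β : E →ₗ[R] E →ₗ[R] M) (y : E) :
    ∑ i, β (y * a i) (b i) = ∑ i, β (a i) (b i * y) := by
  simpa using congrArg (TensorProduct.lift β) (h.comm y)

/-- Absence of π-torsion makes the quotient of the defect by π^k unique, and uniqueness makes it
bilinear. -/
theorem exists_cocycle (hC' : NoTorsion π C) {k : ℕ} (θ : E →ₗ[R] C)
    (hθ : ∀ x y, θ (x * y) - θ x * θ y ∈ powSub π k C) :
    ∃ f : E →ₗ[R] E →ₗ[R] C, ∀ x y, θ (x * y) = θ x * θ y + π ^ k • f x y := by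
  choose f hf using hθ
  replace hf : ∀ x y, π ^ k • f x y = θ (x * y) - θ x * θ y := hf
  refine ⟨LinearMap.mk₂ R f ?_ ?_ ?_ ?_, fun x y => ?_⟩
  · intro x x' y
    refine hC'.pow_cancel (k := k) ?_
    simp only [smul_add, hf, add_mul, map_add]
    abel
  · intro c x y
    refine hC'.pow_cancel (k := k) ?_
    rw [smul_comm]
    simp only [hf, smul_mul_assoc, map_smul, smul_sub]
  · intro x y y'
    refine hC'.pow_cancel (k := k) ?_
    simp only [smul_add, hf, mul_add, map_add]
    abel
  · intro c x y
    refine hC'.pow_cancel (k := k) ?_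
    rw [smul_comm]
    simp only [hf, mul_smul_comm, map_smul, smul_sub]
  · simp [hf]

-- The defect f of θ is a Hochschild 2-cocycle, and a separability idempotent gives a contracting
-- homotopy. Modulo π, f is therefore the coboundary of an explicit linear map H, and adding π^(k+1)
-- H to θ gains one power of π.
set_option maxHeartbeats 800000 in
theorem exists_better_lift (hC' : NoTorsion π C) {a b : ι → E} (hab : IsSeparability R a b)
    {k : ℕ} (θ : E →ₗ[R] C) (hθ : ∀ x y, θ (x * y) - θ x * θ y ∈ powSub π (k + 1) C)
    (h1 : θ 1 - 1 ∈ powSub π 1 C) :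
    ∃ θ' : E →ₗ[R] C, (∀ x, θ' x - θ x ∈ powSub π (k + 1) C) ∧
      ∀ x y, θ' (x * y) - θ' x * θ' y ∈ powSub π (k + 2) C := by
  obtain ⟨f, hf⟩ := exists_cocycle hC' θ hθ
  -- The two expansions of θ(xyz), divided by π^(k+1). The identity is exact, not merely modulo π.
  have coc : ∀ x y z, θ x * f y z - f (x * y) z + f x (y * z) - f x y * θ z = 0 := by
    intro x y z
    refine hC'.pow (k := k + 1) ?_
    have e1 : θ (x * y * z) = θ x * θ y * θ z + π ^ (k + 1) • (f x y * θ z)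
        + π ^ (k + 1) • f (x * y) z := by
      rw [hf, hf, add_mul, smul_mul_assoc]
    have e2 : θ (x * y * z) = θ x * θ y * θ z + π ^ (k + 1) • (θ x * f y z)
        + π ^ (k + 1) • f x (y * z) := by
      rw [mul_assoc, hf, hf, mul_add, mul_smul_comm, mul_assoc]
    have e3 := e1.symm.trans e2
    rw [add_assoc, add_assoc, add_left_cancel_iff, ← sub_eq_zero] at e3
    rw [smul_sub, smul_add, smul_sub, ← neg_eq_zero, ← e3]
    abel
  let H : E →ₗ[R] C := ∑ i, (LinearMap.mulLeft R (θ (a i))).comp (f (b i))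
  have hH : ∀ y, H y = ∑ i, θ (a i) * f (b i) y := fun y => by simp [H]
  refine ⟨θ + π ^ (k + 1) • H, fun x => ⟨H x, by simp⟩, fun x y => ?_⟩
  have s1 : (∑ i, θ (a i) * θ (b i)) * f x y - ∑ i, θ (a i) * f (b i * x) y + H (x * y)
      - H x * θ y = 0 := by
    rw [hH, hH, Finset.sum_mul, Finset.sum_mul, ← Finset.sum_sub_distrib, ← Finset.sum_add_distrib,
      ← Finset.sum_sub_distrib]
    refine Finset.sum_eq_zero fun i _ => ?_
    have := congrArg (θ (a i) * ·) (coc (b i) x y)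
    simpa [mul_add, mul_sub, mul_assoc] using this
  have s2 : ∑ i, θ (a i) * f (b i * x) y =
      θ x * H y + π ^ (k + 1) • ∑ i, f x (a i) * f (b i) y := by
    have := hab.bilin ((LinearMap.mul R C).compl₁₂ θ (f.flip y)) x
    simp only [LinearMap.compl₁₂_apply, LinearMap.mul_apply', LinearMap.flip_apply] at this
    rw [← this, hH, Finset.mul_sum, Finset.smul_sum, ← Finset.sum_add_distrib]
    refine Finset.sum_congr rfl fun i _ => ?_
    rw [hf, add_mul, smul_mul_assoc, mul_assoc]
  have s3 : ∑ i, θ (a i) * θ (b i) = θ 1 - π ^ (k + 1) • ∑ i, f (a i) (b i) := by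
    rw [← hab.sum_mul, map_sum, Finset.smul_sum, ← Finset.sum_sub_distrib]
    refine Finset.sum_congr rfl fun i _ => ?_
    rw [hf]
    simp
  obtain ⟨c, hc⟩ := mem_powSub_one.1 h1
  have key : f x y + H (x * y) - θ x * H y - H x * θ y ∈ powSub π 1 C := by
    have h2 : f x y + H (x * y) - θ x * H y - H x * θ y =
        π ^ (k + 1) • (∑ i, f (a i) (b i)) * f x y - (θ 1 - 1) * f x y
          + π ^ (k + 1) • ∑ i, f x (a i) * f (b i) y := by
      rw [s2, s3] at s1
      rw [← sub_eq_zero, ← s1, sub_mul, sub_mul, one_mul]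
      abel
    rw [h2]
    have hp : ∀ z : C, π ^ (k + 1) • z ∈ powSub π 1 C := fun z =>
      powSub_antitone (by omega) (smul_mem_powSub (k + 1) z)
    exact add_mem (sub_mem (mul_mem_powSub_right (hp _) _) (mul_mem_powSub_right h1 _)) (hp _)
  have e : (θ + π ^ (k + 1) • H) (x * y) - (θ + π ^ (k + 1) • H) x * (θ + π ^ (k + 1) • H) y =
      π ^ (k + 1) • (f x y + H (x * y) - θ x * H y - H x * θ y)
        - π ^ (k + 1) • π ^ (k + 1) • (H x * H y) := by
    simp only [LinearMap.add_apply, LinearMap.smul_apply, hf, add_mul, mul_add, smul_sub, smul_add,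
      smul_mul_assoc, mul_smul_comm]
    abel
  rw [e]
  -- The quadratic term carries π^(2k+2), and 2k+2 ≥ k+2. This is why the exponents start at 1.
  refine sub_mem (smul_mem_powSub_add (j := k + 1) key) ?_
  exact smul_mem_powSub_add (j := k + 1) (k := 1)
    (powSub_antitone (by omega) (smul_mem_powSub (k + 1) _))

/-- An algebra homomorphism modulo `π` from a separable algebra to a complete algebra lifts. -/
theorem exists_algHom_lift (hC : PiComplete π C) (hC' : NoTorsion π C) {a b : ι → E}
    (hab : IsSeparability R a b) (θ : E →ₗ[R] C)
    (hθ : ∀ x y, θ (x * y) - θ x * θ y ∈ powSub π 1 C) (h1 : θ 1 - 1 ∈ powSub π 1 C) :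
    ∃ φ : E →ₐ[R] C, ∀ x, φ x - θ x ∈ powSub π 1 C := by
  let S : ℕ → Type _ := fun k => {η : E →ₗ[R] C //
    (∀ x y, η (x * y) - η x * η y ∈ powSub π (k + 1) C) ∧ η 1 - 1 ∈ powSub π 1 C}
  have step : ∀ k (η : S k), ∃ η' : S (k + 1), ∀ x, η'.1 x - η.1 x ∈ powSub π (k + 1) C := by
    rintro k ⟨η, hη, hη1⟩
    obtain ⟨η', h, h'⟩ := exists_better_lift hC' hab η hη hη1
    refine ⟨⟨η', h', ?_⟩, h⟩
    have := add_mem (powSub_antitone (j := 1) (by omega) (h 1)) hη1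
    simpa using this
  choose g hg using step
  let s : ∀ k, S k := fun k => Nat.rec ⟨θ, hθ, h1⟩ (fun k η => g k η) k
  have hs : ∀ k x, (s (k + 1)).1 x - (s k).1 x ∈ powSub π (k + 1) C := fun k x => hg k (s k) x
  choose l hl using fun x => hC.prec (fun k => (s k).1 x)
    fun k => powSub_antitone (by omega) (hs k x)
  have ext : ∀ x y : C, (∀ k, x - y ∈ powSub π k C) → x = y := fun x y h =>
    sub_eq_zero.1 (hC.haus _ h)
  have hadd : ∀ x y, l (x + y) = l x + l y := fun x y => ext _ _ fun k => by
    have := sub_mem (hl (x + y) k) (add_mem (hl x k) (hl y k))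
    convert this using 1
    rw [map_add]
    abel
  have hsmul : ∀ (c : R) x, l (c • x) = c • l x := fun c x => ext _ _ fun k => by
    have := sub_mem (hl (c • x) k) (Submodule.smul_mem _ c (hl x k))
    convert this using 1
    rw [map_smul, smul_sub]
    abel
  have hmul : ∀ x y, l (x * y) = l x * l y := fun x y => ext _ _ fun k => by
    have := sub_mem (add_mem (hl (x * y) k) (powSub_antitone (by omega) ((s k).2.1 x y)))
      (mul_sub_mul_mem_powSub (hl x k) (hl y k))
    convert this using 1
    abel
  have hlθ : ∀ x, l x - θ x ∈ powSub π 1 C := fun x => by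
    have : l x - (s 1).1 x + ((s 1).1 x - θ x) ∈ powSub π 1 C := add_mem (hl x 1) (hs 0 x)
    rwa [sub_add_sub_cancel] at this
  -- 1 - l(1) is an idempotent in πC, hence lies in every π^k C and vanishes.
  have hone : l 1 = 1 := by
    have hid : (1 - l 1) * (1 - l 1) = 1 - l 1 := by
      have : l 1 * l 1 = l 1 := by rw [← hmul, mul_one]
      simp [mul_sub, sub_mul, this]
    refine (ext _ _ fun k => ?_).symm
    induction k with
    | zero => simp [powSub_zero]
    | succ k ih =>
      obtain ⟨z, hz⟩ := ih
      have h2 : 1 - l 1 ∈ powSub π 1 C := by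
        have := neg_mem (add_mem (hlθ 1) h1)
        simpa using this
      rw [← hid]
      nth_rw 1 [← hz]
      simp only [LinearMap.lsmul_apply, smul_mul_assoc]
      exact smul_mem_powSub_add (mul_mem_powSub_left z h2)
  refine ⟨AlgHom.ofLinearMap ⟨⟨l, hadd⟩, hsmul⟩ hone hmul, hlθ⟩

end Algebra

end PiAdic

/-! ### Discrete valuation rings from π-adic completeness -/

section CommutativePiAdic

theorem mem_powSub_self {R : Type*} [CommRing R] {π : R} {T : Type*} [CommRing T] [Algebra R T]
    {k : ℕ} {x : T} :
    x ∈ powSub π k T ↔ x ∈ (Ideal.span {algebraMap R T π} ^ k • ⊤ : Submodule T T) := by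
  rw [Ideal.span_singleton_pow, smul_eq_mul, Ideal.mul_top, Ideal.mem_span_singleton, mem_powSub]
  constructor
  · rintro ⟨y, rfl⟩
    exact ⟨y, by rw [Algebra.smul_def, map_pow]⟩
  · rintro ⟨y, rfl⟩
    exact ⟨y, by rw [Algebra.smul_def, map_pow]⟩

theorem piComplete_iff_isAdicComplete {R : Type*} [CommRing R] {π : R} {T : Type*} [CommRing T]
    [Algebra R T] :
    PiComplete π T ↔ IsAdicComplete (Ideal.span {algebraMap R T π}) T := by
  constructor
  · intro h
    refine { haus' := fun x hx => h.haus x fun k => ?_, prec' := fun f hf => ?_ }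
    · have := hx k
      rwa [SModEq.zero, ← mem_powSub_self] at this
    · obtain ⟨l, hl⟩ := h.prec f fun k => by
        have := hf (Nat.le_add_right k 1)
        rw [SModEq.sub_mem, ← mem_powSub_self] at this
        rw [← neg_sub]
        exact neg_mem this
      refine ⟨l, fun k => ?_⟩
      rw [SModEq.sub_mem, ← mem_powSub_self, ← neg_sub]
      exact neg_mem (hl k)
  · intro h
    refine ⟨fun x hx => h.haus' x fun k => ?_, fun f hf => ?_⟩
    · rw [SModEq.zero, ← mem_powSub_self]
      exact hx k
    · have hf' : ∀ m j, f m - f (m + j) ∈ powSub π m T := by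
        intro m j
        induction j with
        | zero => simp
        | succ j ih =>
          have := sub_mem ih (powSub_antitone (Nat.le_add_right m j) (hf (m + j)))
          convert this using 1
          rw [← add_assoc]
          abel
      obtain ⟨l, hl⟩ := h.prec' f fun {m n} hmn => by
        obtain ⟨j, rfl⟩ := Nat.exists_eq_add_of_le hmn
        rw [SModEq.sub_mem, ← mem_powSub_self]
        exact hf' m j
      refine ⟨l, fun k => ?_⟩
      have := hl k
      rw [SModEq.sub_mem, ← mem_powSub_self] at this
      rw [← neg_sub]
      exact neg_mem this

/-- Completeness makes T local with maximal ideal (ϖ). Separatedness writes each nonzero x as ϖ^n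
times a unit, and absence of torsion keeps the powers of ϖ nonzero. -/
theorem isDiscreteValuationRing_of_piComplete {T : Type*} [CommRing T] (ϖ : T)
    [hm : (Ideal.span {ϖ}).IsMaximal] (hT : PiComplete ϖ T) (hT' : NoTorsion ϖ T) :
    ∃ _ : IsDomain T, IsDiscreteValuationRing T ∧ ∀ x, x ∉ Ideal.span {ϖ} → IsUnit x := by
  have hc : IsAdicComplete (Ideal.span {ϖ}) T := by
    rwa [piComplete_iff_isAdicComplete, Algebra.algebraMap_self_apply] at hT
  have hloc : IsLocalRing T := isLocalRing_of_isAdicComplete_maximal (Ideal.span {ϖ})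
  have hmax : Ideal.span {ϖ} = IsLocalRing.maximalIdeal T := IsLocalRing.eq_maximalIdeal hm
  have hu : ∀ x, x ∉ Ideal.span {ϖ} → IsUnit x := fun x hx => by
    rw [hmax, IsLocalRing.mem_maximalIdeal, mem_nonunits_iff, not_not] at hx
    exact hx
  have hfac : ∀ x : T, x ≠ 0 → ∃ n : ℕ, ∃ y, IsUnit y ∧ ϖ ^ n * y = x := by
    intro x hx
    have : ∃ k, x ∉ powSub ϖ k T := by
      by_contra! h
      exact hx (hT.haus x h)
    classical
    have h0 : Nat.find this ≠ 0 := fun h => Nat.find_spec this (by rw [h, powSub_zero]; trivial)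
    obtain ⟨n, hn⟩ := Nat.exists_eq_succ_of_ne_zero h0
    have hx' : x ∈ powSub ϖ n T := by
      by_contra h
      have := Nat.find_min' this h
      omega
    obtain ⟨y, rfl⟩ := hx'
    refine ⟨n, y, hu y fun hy => Nat.find_spec this ?_, rfl⟩
    rw [hn]
    obtain ⟨z, rfl⟩ := Ideal.mem_span_singleton'.1 hy
    exact ⟨z, by simp [pow_succ, mul_assoc, mul_comm, mul_left_comm]⟩
  have hne : ∀ n : ℕ, ϖ ^ n ≠ 0 := fun n h => by
    have h1 : (1 : T) = 0 := hT'.pow (k := n) (by rw [h, zero_smul])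
    exact one_ne_zero h1
  have hdom : IsDomain T := by
    have : NoZeroDivisors T := ⟨fun {x y} hxy => by
      by_contra! h
      obtain ⟨n, y, hy, rfl⟩ := hfac x h.1
      obtain ⟨m, z, hz, rfl⟩ := hfac _ h.2
      rw [mul_mul_mul_comm, ← pow_add] at hxy
      exact hne _ ((hy.mul hz).mul_left_eq_zero.1 hxy)⟩
    exact NoZeroDivisors.to_isDomain T
  refine ⟨hdom, ?_, hu⟩
  have hirr : Irreducible ϖ := by
    have h1 : ϖ ≠ 0 := by simpa using hne 1
    exact (((Ideal.span_singleton_prime h1).1 hm.isPrime)).irreducible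
  refine IsDiscreteValuationRing.ofHasUnitMulPowIrreducibleFactorization
    ⟨ϖ, hirr, fun {x} hx => ?_⟩
  obtain ⟨n, y, hy, rfl⟩ := hfac x hx
  exact ⟨n, hy.unit, rfl⟩

end CommutativePiAdic

/-! ### Local uniformizers at a prime of a Dedekind domain -/

section Uniformizer

variable {D : Type u} [CommRing D]

/-- `π ∈ P` generates `P` after inverting an element `s ∉ P`. -/
structure IsLocalUniformizer (P : Ideal D) (π s : D) : Prop where
  mem : π ∈ P
  notMem : s ∉ P
  mul_mem : ∀ p ∈ P, ∃ r, s * p = π * r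
  ne_zero : π ≠ 0

/-- Take π ∈ P \ P² and write (π) = PI. Then I ⊄ P, and any s ∈ I \ P satisfies sP ⊆ PI = (π). -/
theorem exists_isLocalUniformizer [IsDedekindDomain D] (P : Ideal D) [hP : P.IsPrime]
    (hP0 : P ≠ ⊥) : ∃ π s, IsLocalUniformizer P π s := by
  have hlt : P ^ 2 < P := by
    simpa using Ideal.pow_succ_lt_pow hP0 1
  obtain ⟨π, hπ, hπ2⟩ := SetLike.exists_of_lt hlt
  obtain ⟨I, hI⟩ : P ∣ Ideal.span {π} := Ideal.dvd_iff_le.2 (by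
    rwa [Ideal.span_le, Set.singleton_subset_iff])
  have hIP : ¬ I ≤ P := fun h => hπ2 (by
    have : Ideal.span {π} ≤ P ^ 2 := by
      rw [hI, pow_two]
      exact Ideal.mul_mono_right h
    exact this (Ideal.mem_span_singleton_self π))
  obtain ⟨s, hs, hsP⟩ := SetLike.not_le_iff_exists.1 hIP
  refine ⟨π, s, hπ, hsP, fun p hp => ?_, fun h => hπ2 (h ▸ zero_mem _)⟩
  have : p * s ∈ Ideal.span {π} := hI ▸ Ideal.mul_mem_mul hp hs
  obtain ⟨r, hr⟩ := Ideal.mem_span_singleton'.1 this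
  exact ⟨r, by rw [mul_comm, ← hr, mul_comm]⟩

variable {P : Ideal D} [hP : P.IsMaximal] {π s : D} (h : IsLocalUniformizer P π s)
  {A : Type v} [Ring A] [Algebra D A]

theorem exists_mul_sub_one_mem_pow {s : D} (hs : s ∉ P) (k : ℕ) : ∃ r, r * s - 1 ∈ P ^ k := by
  have h1 : IsCoprime (Ideal.span {s}) (P ^ k) := by
    refine IsCoprime.pow_right ?_
    rw [Ideal.isCoprime_iff_sup_eq, sup_comm]
    exact hP.out.2 _ (lt_of_le_of_ne le_sup_left fun h => hs (by
      rw [h]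
      exact Ideal.mem_sup_right (Ideal.mem_span_singleton_self s)))
  obtain ⟨x, hx, y, hy, hxy⟩ := Ideal.isCoprime_iff_exists.1 h1
  obtain ⟨r, rfl⟩ := Ideal.mem_span_singleton'.1 hx
  exact ⟨r, by rw [← hxy]; simpa using neg_mem hy⟩

omit hP in
theorem smul_mem_powIdeal {k : ℕ} {p : D} (hp : p ∈ P ^ k) (a : A) : p • a ∈ powIdeal P A k := by
  rw [Algebra.smul_def]
  exact (powIdeal P A k).mul_mem_right _ (Ideal.mem_map_of_mem _ hp)

omit hP in
theorem smul_mem_powIdeal' {k : ℕ} (p : D) {a : A} (ha : a ∈ powIdeal P A k) :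
    p • a ∈ powIdeal P A k := by
  rw [Algebra.smul_def]
  exact Ideal.mul_mem_left _ _ ha

/-- An element outside the maximal ideal P is invertible modulo every P^k. -/
theorem mem_powIdeal_of_smul_mem {s : D} (hs : s ∉ P) {k : ℕ} {a : A}
    (ha : s • a ∈ powIdeal P A k) : a ∈ powIdeal P A k := by
  obtain ⟨r, hr⟩ := exists_mul_sub_one_mem_pow hs k
  have h1 := smul_mem_powIdeal hr a
  have h2 := smul_mem_powIdeal' r ha
  have := sub_mem h2 h1
  simpa [sub_smul, mul_smul] using this

include h

omit hP in
theorem IsLocalUniformizer.pow_smul_eq {k : ℕ} {a : A} (ha : a ∈ powIdeal P A k) :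
    ∃ b, s ^ k • a = π ^ k • b := by
  have hD : ∀ k, ∀ p ∈ P ^ k, ∃ r, s ^ k * p = π ^ k * r := by
    intro k
    induction k with
    | zero => exact fun p _ => ⟨p, by simp⟩
    | succ k ih =>
      intro p hp
      rw [pow_succ] at hp
      refine Submodule.mul_induction_on hp (fun x hx y hy => ?_) fun x y hx hy => ?_
      · obtain ⟨r, hr⟩ := ih x hx
        obtain ⟨r', hr'⟩ := h.mul_mem y hy
        exact ⟨r * r', by linear_combination (s * y) * hr + (π ^ k * r) * hr'⟩
      · obtain ⟨r, hr⟩ := hx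
        obtain ⟨r', hr'⟩ := hy
        exact ⟨r + r', by rw [mul_add, mul_add, hr, hr']⟩
  refine Submodule.span_induction ?_ ?_ ?_ ?_ ha
  · rintro _ ⟨d, hd, rfl⟩
    obtain ⟨r, hr⟩ := hD k d hd
    refine ⟨algebraMap D A r, ?_⟩
    rw [Algebra.smul_def, Algebra.smul_def, ← map_mul, ← map_mul, hr]
  · exact ⟨0, by simp⟩
  · rintro x y _ _ ⟨b, hb⟩ ⟨c, hc⟩
    exact ⟨b + c, by rw [smul_add, smul_add, hb, hc]⟩
  · rintro x y _ ⟨b, hb⟩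
    exact ⟨x * b, by rw [smul_eq_mul, ← mul_smul_comm, hb, mul_smul_comm]⟩

/-- After multiplication by a power of s, membership in P^(j+k)A becomes divisibility by π^(j+k).
Torsion-freeness cancels π^j, and the power of s is invertible modulo P^k. -/
theorem IsLocalUniformizer.mem_of_smul_mem [IsDomain D] [Module.IsTorsionFree D A] {j k : ℕ} {a : A}
    (ha : π ^ j • a ∈ powIdeal P A (j + k)) : a ∈ powIdeal P A k := by
  obtain ⟨b, hb⟩ := h.pow_smul_eq ha
  have hπ : π ^ j ≠ 0 := pow_ne_zero _ h.ne_zero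
  have : s ^ (j + k) • a = π ^ k • b := by
    refine smul_right_injective A hπ ?_
    change π ^ j • s ^ (j + k) • a = π ^ j • π ^ k • b
    rw [smul_comm, hb, pow_add, mul_smul]
  refine mem_powIdeal_of_smul_mem (s := s ^ (j + k)) (fun hs => h.notMem ?_) ?_
  · exact hP.isPrime.mem_of_pow_mem _ hs
  · rw [this]
    exact smul_mem_powIdeal (Ideal.pow_mem_pow h.mem k) b

end Uniformizer

/-! ### The completion of D at P: uniformizer, completeness, density of D -/

section BaseCompletion

variable {D : Type u} [CommRing D] {P : Ideal D} [hP : P.IsMaximal] {π s : D}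

omit hP in
theorem mem_map_algebraMap_iff (hfg : P.FG) (x : AdicCompletion P D) :
    x ∈ P.map (algebraMap D (AdicCompletion P D)) ↔ AdicCompletion.evalOneₐ P x = 0 := by
  rw [← AdicCompletion.ker_evalOneₐ_eq_map P hfg]
  rfl

omit hP in
theorem algebraMap_mem_map_iff (hfg : P.FG) (d : D) :
    algebraMap D (AdicCompletion P D) d ∈ P.map (algebraMap D (AdicCompletion P D)) ↔ d ∈ P := by
  rw [mem_map_algebraMap_iff hfg, AlgHom.commutes, ← Ideal.Quotient.eq_zero_iff_mem]
  rfl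

theorem isUnit_algebraMap_completion (hfg : P.FG) {s : D} (hs : s ∉ P) :
    IsUnit (algebraMap D (AdicCompletion P D) s) := by
  have := AdicCompletion.isMaximal_map_of_le P P le_rfl hfg
  have := AdicCompletion.isAdicComplete_self P hfg
  have hloc := isLocalRing_of_isAdicComplete_maximal (P.map (algebraMap D (AdicCompletion P D)))
  have hmax := IsLocalRing.eq_maximalIdeal
    (AdicCompletion.isMaximal_map_of_le P P le_rfl hfg)
  by_contra hu
  rw [← mem_nonunits_iff, ← IsLocalRing.mem_maximalIdeal, ← hmax, algebraMap_mem_map_iff hfg] at hu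
  exact hs hu

theorem IsLocalUniformizer.map_eq_span (h : IsLocalUniformizer P π s) (hfg : P.FG) :
    P.map (algebraMap D (AdicCompletion P D)) =
      Ideal.span {algebraMap D (AdicCompletion P D) π} := by
  refine le_antisymm (Ideal.map_le_iff_le_comap.2 fun p hp => ?_) ?_
  · obtain ⟨r, hr⟩ := h.mul_mem p hp
    obtain ⟨u, hu⟩ := isUnit_algebraMap_completion hfg h.notMem
    rw [Ideal.mem_comap, Ideal.mem_span_singleton]
    refine ⟨↑u⁻¹ * algebraMap D _ r, ?_⟩
    rw [mul_left_comm, ← map_mul, ← hr, map_mul, ← hu, Units.inv_mul_cancel_left]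
  · rw [Ideal.span_le, Set.singleton_subset_iff]
    exact Ideal.mem_map_of_mem _ h.mem

theorem IsLocalUniformizer.piComplete_base (h : IsLocalUniformizer P π s) (hfg : P.FG) :
    PiComplete (algebraMap D (AdicCompletion P D) π) (AdicCompletion P D) := by
  rw [piComplete_iff_isAdicComplete, Algebra.algebraMap_self_apply, ← h.map_eq_span hfg]
  exact AdicCompletion.isAdicComplete_self P hfg

theorem IsLocalUniformizer.exists_sub_mem_powSub (h : IsLocalUniformizer P π s) (hfg : P.FG)
    (k : ℕ) (x : AdicCompletion P D) : ∃ d, x - algebraMap D (AdicCompletion P D) d ∈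
      powSub (algebraMap D (AdicCompletion P D) π) k (AdicCompletion P D) := by
  induction k generalizing x with
  | zero => exact ⟨0, by simp [powSub_zero]⟩
  | succ k ih =>
    obtain ⟨d, hd⟩ := Ideal.Quotient.mk_surjective (AdicCompletion.evalOneₐ P x)
    have : x - algebraMap D _ d ∈ P.map (algebraMap D (AdicCompletion P D)) := by
      rw [mem_map_algebraMap_iff hfg, map_sub, ← hd, AlgHom.commutes]
      exact sub_self _
    rw [h.map_eq_span hfg] at this
    obtain ⟨y, hy⟩ := Ideal.mem_span_singleton'.1 this
    obtain ⟨e, z, he⟩ := ih y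
    refine ⟨d + π * e, z, ?_⟩
    simp only [LinearMap.lsmul_apply, smul_eq_mul] at he ⊢
    rw [pow_succ', mul_assoc, he, map_add, map_mul]
    linear_combination hy

theorem IsLocalUniformizer.noTorsion_base [IsDomain D] (h : IsLocalUniformizer P π s) :
    NoTorsion (algebraMap D (AdicCompletion P D) π) (AdicCompletion P D) := by
  intro x hx
  refine AdicCompletion.ext_evalₐ fun k => ?_
  obtain ⟨d, hd⟩ := Ideal.Quotient.mk_surjective (AdicCompletion.evalₐ P (k + 1) x)
  have h1 : Ideal.Quotient.mk (P ^ (k + 1)) (π * d) = 0 := by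
    rw [map_mul, hd]
    have := congrArg (AdicCompletion.evalₐ P (k + 1)) hx
    rw [smul_eq_mul, map_mul, AlgHom.commutes, map_zero] at this
    exact this
  have h2 : d ∈ P ^ k := by
    rw [Ideal.Quotient.eq_zero_iff_mem, add_comm] at h1
    have := h.mem_of_smul_mem (A := D) (j := 1) (k := k) (a := d) (by
      simpa [powIdeal] using h1)
    simpa [powIdeal] using this
  obtain ⟨x, rfl⟩ := AdicCompletion.mk_surjective P D x
  rw [AdicCompletion.evalₐ_mk] at hd
  rw [AdicCompletion.evalₐ_mk, map_zero, ← AdicCompletion.Ideal.mk_eq_mk P (Nat.le_succ k) x,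
    Ideal.Quotient.eq_zero_iff_mem]
  have h3 := Ideal.pow_le_pow_right (Nat.le_succ k) (Ideal.Quotient.eq.1 hd)
  have := sub_mem h2 h3
  simpa using this

end BaseCompletion

/-! ### The completion of A at P as a π-adically complete, torsion-free algebra -/

section Completion

variable {D : Type u} [CommRing D] {P : Ideal D} {A : Type v} [Ring A] [Algebra D A]

variable (P A) in
/-- The projection `Â_P → A / P ^ k A`. -/
def evalCompl (k : ℕ) : Compl P A →+* A ⧸ powIdeal P A k :=
  (Pi.evalRingHom _ k).comp (complSubring P A).subtype

variable (P A) in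
/-- The canonical map `A → Â_P`. -/
def toCompl : A →+* Compl P A :=
  RingHom.codRestrict (RingHom.pi fun k => Ideal.Quotient.mk (powIdeal P A k))
    (complSubring P A) fun _ _ _ _ => rfl

theorem evalCompl_toCompl (k : ℕ) (a : A) :
    evalCompl P A k (toCompl P A a) = Ideal.Quotient.mk (powIdeal P A k) a := rfl

theorem Compl.ext {x y : Compl P A} (h : ∀ k, evalCompl P A k x = evalCompl P A k y) : x = y :=
  Subtype.ext (funext h)

theorem factor_evalCompl {j k : ℕ} (h : j ≤ k) (x : Compl P A) :
    Ideal.Quotient.factor (powIdeal_antitone P A h) (evalCompl P A k x) = evalCompl P A j x :=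
  x.2 j k h

theorem algebraMap_compl (d : D) :
    algebraMap (AdicCompletion P D) (Compl P A) (algebraMap D _ d) =
      toCompl P A (algebraMap D A d) := by
  refine Compl.ext fun k => ?_
  change quotMap P A k (AdicCompletion.evalₐ P k (algebraMap D _ d)) = _
  rw [AlgHom.commutes]
  rfl

theorem algebraMap_smul_compl (d : D) (x : Compl P A) :
    algebraMap D (AdicCompletion P D) d • x = toCompl P A (algebraMap D A d) * x := by
  rw [Algebra.smul_def, algebraMap_compl]

theorem toCompl_smul (d : D) (a : A) :
    toCompl P A (d • a) = algebraMap D (AdicCompletion P D) d • toCompl P A a := by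
  rw [algebraMap_smul_compl, Algebra.smul_def, map_mul]

theorem exists_compl_of_coherent (a : ℕ → A) (ha : ∀ k, a (k + 1) - a k ∈ powIdeal P A k) :
    ∃ x : Compl P A, ∀ k, evalCompl P A k x = Ideal.Quotient.mk _ (a k) := by
  have h : ∀ k j, a (k + j) - a k ∈ powIdeal P A k := by
    intro k j
    induction j with
    | zero => simp
    | succ j ih =>
      have := add_mem (powIdeal_antitone P A (Nat.le_add_right k j) (ha (k + j))) ih
      simpa [← add_assoc] using this
  refine ⟨⟨fun k => Ideal.Quotient.mk _ (a k), fun m n hmn => ?_⟩, fun k => rfl⟩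
  obtain ⟨j, rfl⟩ := Nat.exists_eq_add_of_le hmn
  rw [Ideal.Quotient.factor_mk]
  exact Ideal.Quotient.eq.2 (h m j)

theorem exists_coherent (x : Compl P A) : ∃ a : ℕ → A,
    (∀ k, evalCompl P A k x = Ideal.Quotient.mk _ (a k)) ∧
      ∀ j k, j ≤ k → a k - a j ∈ powIdeal P A j := by
  choose a ha using fun k => Ideal.Quotient.mk_surjective (evalCompl P A k x)
  refine ⟨a, fun k => (ha k).symm, fun j k hjk => ?_⟩
  rw [← Ideal.Quotient.eq, ha j, ← factor_evalCompl hjk, ← ha k, Ideal.Quotient.factor_mk]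

theorem evalCompl_surjective (k : ℕ) : Function.Surjective (evalCompl P A k) := fun x => by
  obtain ⟨a, rfl⟩ := Ideal.Quotient.mk_surjective x
  exact ⟨toCompl P A a, rfl⟩

variable [IsDomain D] [hP : P.IsMaximal] [Module.IsTorsionFree D A] {π s : D}
  (h : IsLocalUniformizer P π s)

include h

/-- Identifies the inverse-limit filtration with the π-adic one. If the k-th component of x
vanishes, the representatives satisfy s^k a_(k+j) = π^k b_j. The b_j are again coherent, their limit
y has s^k x = π^k y, and s is a unit in D̂_P. -/
theorem IsLocalUniformizer.mem_powSub_compl_iff (hfg : P.FG) (k : ℕ) (x : Compl P A) :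
    x ∈ powSub (algebraMap D (AdicCompletion P D) π) k (Compl P A) ↔ evalCompl P A k x = 0 := by
  constructor
  · rintro ⟨y, rfl⟩
    obtain ⟨a, ha⟩ := Ideal.Quotient.mk_surjective (evalCompl P A k y)
    rw [LinearMap.lsmul_apply, ← map_pow, algebraMap_smul_compl, map_mul, evalCompl_toCompl, ← ha,
      ← map_mul, Ideal.Quotient.eq_zero_iff_mem, ← Algebra.smul_def]
    exact smul_mem_powIdeal (Ideal.pow_mem_pow h.mem k) a
  · intro hx
    obtain ⟨a, ha, hac⟩ := exists_coherent x
    have hak : a k ∈ powIdeal P A k := by rw [← Ideal.Quotient.eq_zero_iff_mem, ← ha, hx]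
    have h1 : ∀ j, a (k + j) ∈ powIdeal P A k := fun j => by
      have := add_mem (hac k (k + j) (by omega)) hak
      simpa using this
    choose b hb using fun j => h.pow_smul_eq (h1 j)
    obtain ⟨y, hy⟩ := exists_compl_of_coherent (P := P) b fun j => by
      refine h.mem_of_smul_mem (j := k) ?_
      rw [smul_sub, ← hb, ← hb, ← smul_sub]
      exact smul_mem_powIdeal' _ (hac _ _ (by omega))
    obtain ⟨u, hu⟩ := (isUnit_algebraMap_completion hfg h.notMem).pow k
    have key : (u : AdicCompletion P D) • x =
        algebraMap D (AdicCompletion P D) π ^ k • y := by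
      rw [hu, ← map_pow, ← map_pow, algebraMap_smul_compl, algebraMap_smul_compl]
      refine Compl.ext fun j => ?_
      rw [map_mul, map_mul, evalCompl_toCompl, evalCompl_toCompl, ha, hy, ← map_mul, ← map_mul,
        Ideal.Quotient.eq, ← Algebra.smul_def, ← Algebra.smul_def, ← hb, ← smul_sub, ← neg_sub]
      exact smul_mem_powIdeal' _ (neg_mem (hac _ _ (by omega)))
    refine ⟨((u⁻¹ : (AdicCompletion P D)ˣ) : AdicCompletion P D) • y, ?_⟩
    rw [LinearMap.lsmul_apply, smul_comm, ← key, smul_smul, Units.inv_mul, one_smul]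

theorem IsLocalUniformizer.piComplete_compl (hfg : P.FG) :
    PiComplete (algebraMap D (AdicCompletion P D) π) (Compl P A) where
  haus x hx := Compl.ext fun k => by
    rw [map_zero]
    exact (h.mem_powSub_compl_iff hfg k x).1 (hx k)
  prec x hx := by
    simp only [h.mem_powSub_compl_iff hfg, map_sub, sub_eq_zero] at hx ⊢
    refine ⟨⟨fun k => evalCompl P A k (x k), fun m n hmn => ?_⟩, fun k => rfl⟩
    refine (factor_evalCompl hmn _).trans ?_
    obtain ⟨j, rfl⟩ := Nat.exists_eq_add_of_le hmn
    induction j with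
    | zero => rfl
    | succ j ih =>
      rw [← ih (by omega), ← factor_evalCompl (Nat.le_add_right m j), ← add_assoc, hx (m + j),
        factor_evalCompl]
      exact Nat.le_add_right m j

theorem IsLocalUniformizer.noTorsion_compl :
    NoTorsion (algebraMap D (AdicCompletion P D) π) (Compl P A) := by
  intro x hx
  obtain ⟨a, ha, hac⟩ := exists_coherent x
  refine Compl.ext fun k => ?_
  have h1 := congrArg (evalCompl P A (1 + k)) hx
  rw [algebraMap_smul_compl, map_mul, ha, evalCompl_toCompl, map_zero, ← map_mul,
    Ideal.Quotient.eq_zero_iff_mem, ← Algebra.smul_def] at h1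
  have h2 := h.mem_of_smul_mem (j := 1) (by rwa [pow_one])
  rw [map_zero, ← factor_evalCompl (Nat.le_add_left k 1), ha, Ideal.Quotient.factor_mk]
  exact Ideal.Quotient.eq_zero_iff_mem.2 h2

theorem IsLocalUniformizer.exists_sub_toCompl_mem (hfg : P.FG) (k : ℕ) (x : Compl P A) :
    ∃ a, x - toCompl P A a ∈ powSub (algebraMap D (AdicCompletion P D) π) k (Compl P A) := by
  obtain ⟨a, ha⟩ := Ideal.Quotient.mk_surjective (evalCompl P A k x)
  refine ⟨a, ?_⟩
  rw [h.mem_powSub_compl_iff hfg, map_sub, evalCompl_toCompl, ha, sub_self]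

theorem IsLocalUniformizer.toCompl_mem_iff (hfg : P.FG) (k : ℕ) (a : A) :
    toCompl P A a ∈ powSub (algebraMap D (AdicCompletion P D) π) k (Compl P A) ↔
      a ∈ powIdeal P A k := by
  rw [h.mem_powSub_compl_iff hfg, evalCompl_toCompl, Ideal.Quotient.eq_zero_iff_mem]

end Completion

/-! ### Lifting along a reduction map, and separability of unramified algebras -/

section Lifting

variable {R : Type*} [CommRing R] {π : R} {C : Type*} [Ring C] [Algebra R C]
  {E : Type*} [Ring E] [Algebra R E] {ι : Type*} [Fintype ι]

/-- A homomorphism from a free separable algebra to the reduction of a complete algebra lifts. -/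
theorem exists_algHom_lift_of_surjective [Module.Free R E] (hC : PiComplete π C)
    (hC' : NoTorsion π C) {a b : ι → E} (hab : IsSeparability R a b) {Q : Type*} [Ring Q]
    (q : C →+* Q) (hq : Function.Surjective q) (hker : ∀ x, q x = 0 → x ∈ powSub π 1 C)
    (hker' : q (algebraMap R C π) = 0)
    (φ : E →+* Q) (hφ : ∀ r, φ (algebraMap R E r) = q (algebraMap R C r)) :
    ∃ ψ : E →ₐ[R] C, ∀ x, q (ψ x) = φ x := by
  let β := Module.Free.chooseBasis R E
  choose c hc using fun j => hq (φ (β j))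
  let θ : E →ₗ[R] C := β.constr R c
  have hθ : ∀ x, q (θ x) = φ x := by
    intro x
    have hx : x ∈ Submodule.span R (Set.range β) := by rw [β.span_eq]; trivial
    induction hx using Submodule.span_induction with
    | zero => simp
    | add x y _ _ hx hy => rw [map_add, map_add, map_add, hx, hy]
    | smul r x _ hx => rw [map_smul, Algebra.smul_def, Algebra.smul_def, map_mul, map_mul, hφ, hx]
    | mem x hx =>
      obtain ⟨i, rfl⟩ := hx
      rw [← hc, Module.Basis.constr_basis]
  have h1 : ∀ x, x ∈ powSub π 1 C → q x = 0 := fun x hx => by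
    obtain ⟨y, rfl⟩ := mem_powSub_one.1 hx
    rw [Algebra.smul_def, map_mul, hker', zero_mul]
  obtain ⟨ψ, hψ⟩ := exists_algHom_lift hC hC' hab θ (fun x y => hker _ (by simp [hθ]))
    (hker _ (by simp [hθ]))
  refine ⟨ψ, fun x => ?_⟩
  have := h1 _ (hψ x)
  rwa [map_sub, hθ, sub_eq_zero] at this

end Lifting

/-- For commutative T, the canonical element of T ⊗ T attached to an unramified algebra is a
separability idempotent. -/
theorem exists_isSeparability (R : Type*) [CommRing R] (T : Type*) [CommRing T] [Algebra R T]
    [Algebra.FormallyUnramified R T] [Module.Finite R T] :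
    ∃ (m : ℕ) (a b : Fin m → T), IsSeparability R a b := by
  obtain ⟨m, a, b, h⟩ : ∃ (m : ℕ) (a b : Fin m → T),
      Algebra.FormallyUnramified.elem R T = ∑ i, a i ⊗ₜ[R] b i := by
    obtain ⟨s, hs⟩ := TensorProduct.exists_finset (Algebra.FormallyUnramified.elem R T)
    refine ⟨s.card, fun i => (s.equivFin.symm i).1.1, fun i => (s.equivFin.symm i).1.2, ?_⟩
    rw [hs, ← Finset.sum_coe_sort, ← s.equivFin.symm.sum_comp]
  refine ⟨m, a, b, ?_, fun y => ?_⟩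
  · have := Algebra.FormallyUnramified.lmul_elem (R := R) (S := T)
    rw [h, map_sum] at this
    simpa using this
  · have := Algebra.FormallyUnramified.one_tmul_mul_elem (R := R) y
    rw [h, Finset.mul_sum, Finset.mul_sum] at this
    simp only [Algebra.TensorProduct.tmul_mul_tmul, one_mul] at this
    rw [← this]
    simp only [mul_comm y]

/-- Two lifts x, y of the root differ by an element of square zero, so Taylor expansion gives 0 =
g'(y)(x - y) with g'(y) a unit. -/
theorem formallyUnramified_adjoinRoot {R : Type u} [CommRing R] (g : R[X])
    (hg : IsUnit (AdjoinRoot.mk g (Polynomial.derivative g))) :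
    Algebra.FormallyUnramified R (AdjoinRoot g) := by
  rw [Algebra.FormallyUnramified.iff_comp_injective]
  intro B _ _ I hI f₁ f₂ h
  refine AdjoinRoot.algHom_ext ?_
  have hε : f₁ (AdjoinRoot.root g) - f₂ (AdjoinRoot.root g) ∈ I := by
    rw [← Ideal.Quotient.eq]
    exact DFunLike.congr_fun h (AdjoinRoot.root g)
  have hroot : ∀ f : AdjoinRoot g →ₐ[R] B, Polynomial.aeval (f (AdjoinRoot.root g)) g = 0 := by
    intro f
    rw [Polynomial.aeval_algHom_apply, AdjoinRoot.aeval_eq, AdjoinRoot.mk_self, map_zero]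
  set x := f₁ (AdjoinRoot.root g)
  set y := f₂ (AdjoinRoot.root g)
  obtain ⟨c, hc⟩ := Polynomial.binomExpansion (g.map (algebraMap R B)) y (x - y)
  have hsq : (x - y) ^ 2 = 0 := by
    have : (x - y) ^ 2 ∈ I ^ 2 := Ideal.pow_mem_pow hε 2
    rwa [hI] at this
  rw [hsq, mul_zero, add_zero, add_sub_cancel, Polynomial.eval_map_algebraMap,
    Polynomial.eval_map_algebraMap, hroot, hroot, zero_add, Polynomial.derivative_map,
    Polynomial.eval_map_algebraMap] at hc
  have hu : IsUnit (Polynomial.aeval y (Polynomial.derivative g)) := by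
    have := hg.map f₂
    rwa [← AdjoinRoot.aeval_eq, ← Polynomial.aeval_algHom_apply] at this
  exact sub_eq_zero.1 ((hu.mul_right_eq_zero).1 hc.symm)

/-! ### Construction of the unramified extension with a prescribed residue field -/

section Model

variable {R : Type u} [CommRing R] {π : R} [hπ : (Ideal.span {π}).IsMaximal]
  (hR : PiComplete π R) (hR' : NoTorsion π R)

include hR hR'

/-- The properties of the unramified extension `T` of `R` with residue field `F`. -/
structure IsModel {R : Type*} [CommRing R] (π : R) {T F : Type*} [CommRing T] [Algebra R T] [Field F]
    [Algebra R F] {d : ℕ} (b : Module.Basis (Fin d) R T) (ρ : T →ₐ[R] F)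
    (σ : Fin d → T ≃ₐ[R] T) : Prop where
  surj : Function.Surjective ρ
  ker : ∀ x, ρ x = 0 → x ∈ powSub π 1 T
  det : IsUnit (Matrix.of fun i j => σ i (b j)).det
  unramified : Algebra.FormallyUnramified R T
  complete : PiComplete π T
  noTorsion : NoTorsion π T

/-- The unramified extension of `R` with a given finite residue field. -/
theorem exists_isModel (F : Type*) [Field F] [Finite F] [Algebra R F] (hF : algebraMap R F π = 0) :
    ∃ (T : Type u) (_ : CommRing T) (_ : Algebra R T) (d : ℕ) (b : Module.Basis (Fin d) R T)
      (ρ : T →ₐ[R] F) (σ : Fin d → T ≃ₐ[R] T), IsModel π b ρ σ := by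
  classical
  let k := R ⧸ Ideal.span {π}
  let _ : Field k := Ideal.Quotient.field _
  let _ : Algebra k F := (Ideal.Quotient.lift (Ideal.span {π}) (algebraMap R F) fun a ha => by
    obtain ⟨c, rfl⟩ := Ideal.mem_span_singleton'.1 ha
    rw [map_mul, hF, mul_zero]).toAlgebra
  have _ : IsScalarTower R k F := IsScalarTower.of_algebraMap_eq fun r => rfl
  have : Finite k := Finite.of_injective _ (algebraMap k F).injective
  -- Every nonzero element of F is a power of z. This gives F = k[z], surjectivity of ρ, and that
  -- automorphisms of F are determined by their value at z.
  obtain ⟨ζ, hζ⟩ := IsCyclic.exists_generator (α := Fˣ)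
  obtain ⟨z, hz⟩ : ∃ z : F, z = ζ.val := ⟨_, rfl⟩
  have hgen : ∀ x : F, x = 0 ∨ ∃ n : ℕ, z ^ n = x := by
    intro x
    by_cases hx : x = 0
    · exact Or.inl hx
    · have := hζ (Units.mk0 x hx)
      rw [← mem_powers_iff_mem_zpowers] at this
      obtain ⟨n, hn⟩ := this
      exact Or.inr ⟨n, by rw [hz]; simpa using congrArg Units.val hn⟩
  have hint : IsIntegral k z := Algebra.IsIntegral.isIntegral z
  -- T is R[X]/(g) for a monic lift g of the minimal polynomial of z, so it is free over R with
  -- reduction F.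
  obtain ⟨g, hg, -, hgm⟩ := Polynomial.lifts_and_degree_eq_and_monic (f := algebraMap R k)
    (p := minpoly k z) (by
      rw [Polynomial.lifts_iff_coeff_lifts]
      intro n
      exact Ideal.Quotient.mk_surjective _) (minpoly.monic hint)
  have hz0 : Polynomial.aeval z g = 0 := by
    rw [← Polynomial.aeval_map_algebraMap k, hg, minpoly.aeval]
  let T := AdjoinRoot g
  let ρ : T →ₐ[R] F := AdjoinRoot.liftAlgHom g (Algebra.ofId R F) z hz0
  have hρroot : ρ (AdjoinRoot.root g) = z := AdjoinRoot.liftAlgHom_root ..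
  have hsurj : Function.Surjective ρ := by
    intro x
    obtain rfl | ⟨n, rfl⟩ := hgen x
    · exact ⟨0, map_zero _⟩
    · exact ⟨AdjoinRoot.root g ^ n, by rw [map_pow, hρroot]⟩
  have hρmk : ∀ p, ρ (AdjoinRoot.mk g p) = Polynomial.aeval z p := fun p => by
    rw [← AdjoinRoot.aeval_eq, ← Polynomial.aeval_algHom_apply, hρroot]
  have hker : ∀ x, ρ x = 0 → x ∈ powSub π 1 T := by
    intro x hx
    obtain ⟨p, rfl⟩ := AdjoinRoot.mk_surjective x
    rw [hρmk, ← Polynomial.aeval_map_algebraMap k] at hx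
    obtain ⟨q', hq'⟩ := minpoly.dvd k z hx
    obtain ⟨q, rfl⟩ := Polynomial.map_surjective (algebraMap R k) Ideal.Quotient.mk_surjective q'
    rw [← hg, ← Polynomial.map_mul, ← sub_eq_zero, ← Polynomial.map_sub] at hq'
    have : Polynomial.C π ∣ p - g * q := by
      rw [Polynomial.C_dvd_iff_dvd_coeff]
      intro i
      rw [← Ideal.mem_span_singleton, ← Ideal.Quotient.eq_zero_iff_mem]
      have : ((p - g * q).map (algebraMap R k)).coeff i = 0 := by rw [hq', Polynomial.coeff_zero]
      rwa [Polynomial.coeff_map] at this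
    obtain ⟨r, hr⟩ := this
    refine mem_powSub_one.2 ⟨AdjoinRoot.mk g r, ?_⟩
    have := congrArg (AdjoinRoot.mk g) hr
    rw [map_sub, map_mul, AdjoinRoot.mk_self, zero_mul, sub_zero, map_mul, AdjoinRoot.mk_C] at this
    rw [this, Algebra.smul_def]
    rfl
  let b₀ := (AdjoinRoot.powerBasis' hgm).basis
  have hcomp : PiComplete π T := (PiComplete.pi fun _ => hR).congr b₀.equivFun.symm
  have hnt : NoTorsion π T := NoTorsion.of_injective b₀.equivFun.toLinearMap
    b₀.equivFun.injective (NoTorsion.pi fun _ => hR')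
  have hspan : Ideal.span {algebraMap R T π} = RingHom.ker ρ := by
    ext x
    rw [Ideal.mem_span_singleton', RingHom.mem_ker]
    constructor
    · rintro ⟨y, rfl⟩
      rw [map_mul, AlgHom.commutes, hF, mul_zero]
    · intro hx
      obtain ⟨y, rfl⟩ := mem_powSub_one.1 (hker x hx)
      exact ⟨y, by rw [Algebra.smul_def, mul_comm]⟩
  have : (Ideal.span {algebraMap R T π}).IsMaximal := by
    rw [hspan]
    exact RingHom.ker_isMaximal_of_surjective _ hsurj
  have hunit : ∀ x, ρ x ≠ 0 → IsUnit x := by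
    have h1 : PiComplete (algebraMap R T π) T := by
      rw [piComplete_iff_isAdicComplete] at hcomp ⊢
      exact hcomp
    have h2 : NoTorsion (algebraMap R T π) T := fun x hx => hnt x (by rwa [Algebra.smul_def])
    obtain ⟨-, -, h⟩ := isDiscreteValuationRing_of_piComplete _ h1 h2
    intro x hx
    refine h x fun hx' => hx ?_
    rwa [hspan, RingHom.mem_ker] at hx'
  have hfu : Algebra.FormallyUnramified R T := by
    refine formallyUnramified_adjoinRoot g (hunit _ ?_)
    rw [hρmk, ← Polynomial.aeval_map_algebraMap k, ← Polynomial.derivative_map, hg]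
    exact (Algebra.IsSeparable.isSeparable k z).aeval_derivative_ne_zero (minpoly.aeval k z)
  have : Module.Free R T := Module.Free.of_basis b₀
  have : Module.Finite R T := Module.Finite.of_basis b₀
  obtain ⟨m, a, a', hsep⟩ := exists_isSeparability R T
  -- T is separable over R, so each automorphism of the residue field lifts. The lift is bijective
  -- because it is so modulo π.
  have hlift : ∀ τ : F ≃ₐ[k] F, ∃ ψ : T ≃ₐ[R] T, ∀ x, ρ (ψ x) = τ (ρ x) := by
    intro τ
    obtain ⟨ψ, hψ⟩ := exists_algHom_lift_of_surjective hcomp hnt hsep (ρ : T →+* F) hsurj hker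
      (by simpa using hF) ((τ : F →+* F).comp (ρ : T →+* F)) (fun r => by
        simp [IsScalarTower.algebraMap_apply R k F])
    replace hψ : ∀ x, ρ (ψ x) = τ (ρ x) := hψ
    have hbij := bijective_of_bijective_mod hcomp hcomp hnt ψ.toLinearMap (fun y => by
        obtain ⟨x, hx⟩ := hsurj (τ.symm (ρ y))
        exact ⟨x, hker _ (by simp [hψ, hx])⟩)
      (fun x hx => hker _ (τ.injective (by
        rw [map_zero, ← hψ]
        obtain ⟨y, hy⟩ := mem_powSub_one.1 hx
        rw [show ψ x = π • y from hy.symm, map_smul, Algebra.smul_def, hF, zero_mul])))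
    exact ⟨AlgEquiv.ofBijective ψ hbij, hψ⟩
  choose Ψ hΨ using hlift
  -- F/k is Galois, so there are as many automorphisms as basis elements and the matrix of
  -- conjugates is square.
  have hdeg : (AdjoinRoot.powerBasis' hgm).dim = Nat.card (F ≃ₐ[k] F) := by
    rw [IsGalois.card_aut_eq_finrank, AdjoinRoot.powerBasis'_dim,
      ← hgm.natDegree_map (algebraMap R k), hg]
    rw [← IntermediateField.adjoin.finrank hint]
    have : IntermediateField.adjoin k {z} = ⊤ := by
      rw [eq_top_iff]
      intro x _
      obtain rfl | ⟨n, rfl⟩ := hgen x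
      · exact zero_mem _
      · exact pow_mem (IntermediateField.mem_adjoin_simple_self k z) n
    rw [this, IntermediateField.finrank_top']
  let e : Fin (AdjoinRoot.powerBasis' hgm).dim ≃ (F ≃ₐ[k] F) :=
    (finCongr hdeg).trans (Finite.equivFin _).symm
  refine ⟨T, inferInstance, inferInstance, _, b₀, ρ, fun i => Ψ (e i), hsurj, hker, ?_, hfu,
    hcomp, hnt⟩
  -- On the power basis the determinant is Vandermonde. It is a unit since distinct automorphisms
  -- send z to distinct elements of F.
  have : (Matrix.of fun i j => Ψ (e i) (b₀ j)) =
      Matrix.vandermonde fun i => Ψ (e i) (AdjoinRoot.root g) := by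
    ext i j
    simp [b₀, Matrix.vandermonde_apply]
  rw [this, Matrix.det_vandermonde]
  refine IsUnit.prod_iff.2 fun i _ => IsUnit.prod_iff.2 fun j hj => hunit _ ?_
  rw [map_sub, hΨ, hΨ, hρroot, sub_ne_zero]
  intro h
  have : e j = e i := by
    ext x
    obtain rfl | ⟨n, rfl⟩ := hgen x
    · simp
    · rw [map_pow, map_pow, h]
  exact (Finset.mem_Ioi.1 hj).ne' (e.injective this)

end Model

/-! ### Separability idempotents for powers and matrix algebras -/

section Separability

variable {R : Type*} [CommRing R] {ι : Type*} [Fintype ι]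

theorem IsSeparability.pi {E : Type*} [Ring E] [Algebra R E] {a b : ι → E}
    (h : IsSeparability R a b) (κ : Type*) [Fintype κ] [DecidableEq κ] :
    IsSeparability R (E := κ → E) (fun p : κ × ι => Pi.single p.1 (a p.2))
      (fun p : κ × ι => Pi.single p.1 (b p.2)) where
  sum_mul := by
    simp_rw [← Pi.single_mul]
    rw [Fintype.sum_prod_type]
    refine funext fun j => ?_
    simp only [Finset.sum_apply]
    rw [Finset.sum_eq_single j (fun i _ hij => Finset.sum_eq_zero fun l _ => by
      rw [Pi.single_eq_of_ne hij.symm]) (by simp)]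
    simpa using h.sum_mul
  comm y := by
    rw [Fintype.sum_prod_type, Fintype.sum_prod_type]
    refine Finset.sum_congr rfl fun i _ => ?_
    have := h.bilin ((TensorProduct.mk R (κ → E) (κ → E)).compl₁₂
      (LinearMap.single R (fun _ => E) i) (LinearMap.single R (fun _ => E) i)) (y i)
    simpa [Pi.single_mul_left, Pi.single_mul_right] using this

/-- If Σ a_l ⊗ b_l works for T, then Σ a_l E_(p,o) ⊗ b_l E_(o,p) works for matrices, for any fixed
index o. -/
theorem IsSeparability.matrix {T : Type*} [CommRing T] [Algebra R T] {a b : ι → T}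
    (h : IsSeparability R a b) (κ : Type*) [Fintype κ] [DecidableEq κ] (o : κ) :
    IsSeparability R (E := Matrix κ κ T) (fun p : κ × ι => Matrix.single p.1 o (a p.2))
      (fun p : κ × ι => Matrix.single o p.1 (b p.2)) where
  sum_mul := by
    simp_rw [Matrix.single_mul_single_same]
    rw [Fintype.sum_prod_type]
    have : ∀ r : κ, ∑ l, Matrix.single r r (a l * b l) = Matrix.single r r (1 : T) := fun r => by
      rw [← h.sum_mul]
      exact (map_sum (Matrix.singleAddMonoidHom (α := T) (m := κ) (n := κ) r r) _ _).symm
    simp_rw [this]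
    exact Matrix.sum_single_one
  comm y := by
    have hl : ∀ (r : κ) (x : T), y * Matrix.single r o x =
        ∑ v, Matrix.single v o (y v r * x) := by
      intro r x
      conv_lhs => rw [Matrix.matrix_eq_sum_single y]
      simp_rw [Finset.sum_mul]
      refine Finset.sum_congr rfl fun v _ => ?_
      rw [Finset.sum_eq_single r (fun j _ hj => Matrix.single_mul_single_of_ne _ _ _ _ hj _)
        (by simp), Matrix.single_mul_single_same]
    have hr : ∀ (r : κ) (x : T), Matrix.single o r x * y =
        ∑ v, Matrix.single o v (x * y r v) := by
      intro r x
      conv_lhs => rw [Matrix.matrix_eq_sum_single y]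
      simp_rw [Finset.mul_sum]
      rw [Finset.sum_eq_single r (fun j _ hj => Finset.sum_eq_zero fun v _ =>
        Matrix.single_mul_single_of_ne _ _ _ _ hj.symm _) (by simp)]
      exact Finset.sum_congr rfl fun v _ => by rw [Matrix.single_mul_single_same]
    simp_rw [hl, hr, TensorProduct.sum_tmul, TensorProduct.tmul_sum]
    rw [Fintype.sum_prod_type, Fintype.sum_prod_type]
    simp_rw [Finset.sum_comm (s := (Finset.univ : Finset ι))]
    rw [Finset.sum_comm]
    refine Finset.sum_congr rfl fun v _ => Finset.sum_congr rfl fun r _ => ?_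
    have := h.bilin ((TensorProduct.mk R (Matrix κ κ T) (Matrix κ κ T)).compl₁₂
      (Matrix.singleLinearMap R v o) (Matrix.singleLinearMap R o r)) (y v r)
    simpa using this

end Separability

/-! ### The unramified model over the completion of D -/

section Model

variable {D : Type u} [CommRing D] [IsDomain D] {P : Ideal D} [hP : P.IsMaximal] {π s : D}

omit [IsDomain D] in
theorem IsLocalUniformizer.span_isMaximal (h : IsLocalUniformizer P π s) (hfg : P.FG) :
    (Ideal.span {algebraMap D (AdicCompletion P D) π}).IsMaximal := by
  rw [← h.map_eq_span hfg]
  exact AdicCompletion.isMaximal_map_of_le P P le_rfl hfg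

/-- The valuation ring of the unramified extension of `K̂_P` with residue field `F`. -/
theorem exists_isModel_isCompleteUnramified (h : IsLocalUniformizer P π s) (hfg : P.FG)
    (F : Type*) [Field F] [Finite F] [Algebra (AdicCompletion P D) F]
    (hF : algebraMap (AdicCompletion P D) F (algebraMap D _ π) = 0) :
    ∃ (T : Type u) (_ : CommRing T) (_ : IsDomain T) (_ : IsDiscreteValuationRing T)
      (_ : Algebra (AdicCompletion P D) T) (d : ℕ)
      (b : Module.Basis (Fin d) (AdicCompletion P D) T) (ρ : T →ₐ[AdicCompletion P D] F)
      (σ : Fin d → T ≃ₐ[AdicCompletion P D] T),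
      IsModel (algebraMap D (AdicCompletion P D) π) b ρ σ ∧ IsCompleteUnramified P T := by
  have hmax := h.span_isMaximal hfg
  have hR := h.piComplete_base hfg
  have hR' := h.noTorsion_base
  obtain ⟨T, _, _, d, b, ρ, σ, hT⟩ := exists_isModel hR hR' F hF
  have hspan : Ideal.span {algebraMap (AdicCompletion P D) T (algebraMap D _ π)} =
      RingHom.ker ρ := by
    ext x
    rw [Ideal.mem_span_singleton', RingHom.mem_ker]
    constructor
    · rintro ⟨y, rfl⟩
      rw [map_mul, AlgHom.commutes, hF, mul_zero]
    · intro hx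
      obtain ⟨y, rfl⟩ := mem_powSub_one.1 (hT.ker x hx)
      exact ⟨y, by rw [Algebra.smul_def, mul_comm]⟩
  have hmaxT : (Ideal.span {algebraMap (AdicCompletion P D) T (algebraMap D _ π)}).IsMaximal := by
    rw [hspan]
    exact RingHom.ker_isMaximal_of_surjective _ hT.surj
  obtain ⟨hdom, hdvr, -⟩ := isDiscreteValuationRing_of_piComplete _
    (show PiComplete (algebraMap _ T (algebraMap D (AdicCompletion P D) π)) T by
      have := hT.complete
      rw [piComplete_iff_isAdicComplete] at this ⊢
      exact this)
    (fun x hx => hT.noTorsion x (by rwa [Algebra.smul_def]))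
  obtain ⟨hdomR, -, -⟩ := isDiscreteValuationRing_of_piComplete _ hR hR'
  have hm := IsLocalRing.eq_maximalIdeal hmaxT
  have hfree : Module.Free (AdicCompletion P D) T := Module.Free.of_basis b
  have hfin : Module.Finite (AdicCompletion P D) T := Module.Finite.of_basis b
  have hinj : Function.Injective (algebraMap (AdicCompletion P D) T) :=
    FaithfulSMul.algebraMap_injective _ _
  refine ⟨T, inferInstance, hdom, hdvr, inferInstance, d, b, ρ, σ, hT, ?_, ?_, hinj, ?_, ?_⟩
  · rw [← hm]
    exact piComplete_iff_isAdicComplete.1 hT.complete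
  · rw [IsLocalRing.ResidueField, ← hm, hspan]
    exact Finite.of_injective _ (RingHom.kerLift_injective (ρ : T →+* F))
  · let f : FractionRing (AdicCompletion P D) →+* FractionRing T := IsFractionRing.map hinj
    let _ : Algebra (FractionRing (AdicCompletion P D)) (FractionRing T) := f.toAlgebra
    have : IsScalarTower (AdicCompletion P D) (FractionRing (AdicCompletion P D))
        (FractionRing T) := IsScalarTower.of_algebraMap_eq fun x => by
      rw [RingHom.algebraMap_toAlgebra, IsScalarTower.algebraMap_apply _ T (FractionRing T)]
      exact (IsLocalization.map_eq _ x).symm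
    change Module.Finite (FractionRing (AdicCompletion P D)) (FractionRing T)
    exact Module.Finite.of_isLocalization (AdicCompletion P D) T
      (nonZeroDivisors (AdicCompletion P D))
  · rw [h.map_eq_span hfg, Ideal.map_span, Set.image_singleton, hm]

end Model

/-! ### Powers of matrices over a finite field, and Jordan blocks -/

section FiniteMatrixRing

/-- The powers of a matrix over a finite field are eventually periodic from the exponent `n` on. -/
theorem exists_pow_add_eq_pow (F : Type*) [Field F] [Finite F] (n : ℕ) :
    ∃ N : ℕ, 0 < N ∧ ∀ a : Matrix (Fin n) (Fin n) F, a ^ (n + N) = a ^ n := by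
  classical
  obtain ⟨i, j, hij, h⟩ : ∃ i j : ℕ, i < j ∧
      ∀ a : Matrix (Fin n) (Fin n) F, a ^ i = a ^ j := by
    obtain ⟨i, j, hij, h⟩ := Finite.exists_ne_map_eq_of_infinite
      (fun (i : ℕ) (a : Matrix (Fin n) (Fin n) F) => a ^ i)
    rcases lt_or_gt_of_ne hij with hlt | hlt
    · exact ⟨i, j, hlt, fun a => congrFun h a⟩
    · exact ⟨j, i, hlt, fun a => (congrFun h a).symm⟩
  refine ⟨j - i, by omega, fun a => ?_⟩
  let φ := Matrix.toLinAlgEquiv' (R := F) (n := Fin n)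
  -- Kernels of powers stabilize at exponent n, so a relation holding after multiplication by
  -- a^(n+i) already holds after multiplication by a^n.
  have hker := Module.End.ker_pow_eq_ker_pow_finrank_of_le (f := φ a) (m := n + i) (by simp)
  rw [Module.finrank_fin_fun] at hker
  refine φ.injective (LinearMap.ext fun x => ?_)
  have h1 : ((φ a) ^ (j - i) - 1) x ∈ LinearMap.ker ((φ a) ^ (n + i)) := by
    rw [LinearMap.mem_ker, ← Module.End.mul_apply, mul_sub, mul_one, ← pow_add,
      show n + i + (j - i) = n + j by omega, pow_add, pow_add, ← map_pow, ← map_pow, ← map_pow, h a,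
      sub_self, LinearMap.zero_apply]
  rw [hker, LinearMap.mem_ker, ← Module.End.mul_apply, mul_sub, mul_one, ← pow_add,
    LinearMap.sub_apply, sub_eq_zero] at h1
  simpa using h1

/-- The nilpotent Jordan block of size `n`. -/
def jordan (n : ℕ) (F : Type*) [Semiring F] : Matrix (Fin n) (Fin n) F :=
  Matrix.of fun i j => if (i : ℕ) + 1 = j then 1 else 0

theorem jordan_pow (n : ℕ) (F : Type*) [Semiring F] (k : ℕ) :
    jordan n F ^ k = Matrix.of fun i j : Fin n => if (i : ℕ) + k = j then 1 else 0 := by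
  induction k with
  | zero =>
    ext i j
    simp [Matrix.one_apply, Fin.ext_iff]
  | succ k ih =>
    ext i j
    rw [pow_succ, ih, jordan, Matrix.mul_apply]
    simp only [Matrix.of_apply, ite_mul, one_mul, zero_mul]
    by_cases hi : (i : ℕ) + k < n
    · rw [Finset.sum_eq_single (⟨i + k, hi⟩ : Fin n) (fun l _ hl => if_neg fun h => hl
        (Fin.ext h.symm)) (by simp)]
      simp [add_assoc]
    · rw [Finset.sum_eq_zero fun l _ => if_neg (by have := l.2; omega), if_neg]
      have := j.2
      omega

theorem jordan_pow_self (n : ℕ) (F : Type*) [Semiring F] : jordan n F ^ n = 0 := by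
  rw [jordan_pow]
  ext i j
  have := j.2
  exact if_neg (by omega)

theorem jordan_pow_ne_zero {n k : ℕ} (F : Type*) [Semiring F] [Nontrivial F] (h : k < n) :
    jordan n F ^ k ≠ 0 := by
  intro h0
  rw [jordan_pow] at h0
  have := congrFun (congrFun h0 ⟨0, by omega⟩) ⟨k, h⟩
  simp at this

/-- The last element of `Fin n` for nonzero `n`. -/
def finLast (n : ℕ) [NeZero n] : Fin n := ⟨n - 1, Nat.sub_one_lt (NeZero.ne n)⟩

theorem jordan_pow_pred (n : ℕ) [NeZero n] (F : Type*) [Semiring F] :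
    jordan n F ^ (n - 1) = Matrix.single 0 (finLast n) 1 := by
  rw [jordan_pow]
  ext i j
  simp only [Matrix.of_apply, Matrix.single_apply, Fin.ext_iff, Fin.val_zero, finLast]
  have := i.2
  have := j.2
  split_ifs <;> first | rfl | omega

theorem single_last_mul_jordan (n : ℕ) [NeZero n] (F : Type*) [Semiring F] (p : Fin n) :
    Matrix.single p (finLast n) (1 : F) * jordan n F = 0 := by
  ext i j
  rw [Matrix.mul_apply]
  refine Finset.sum_eq_zero fun l _ => ?_
  simp only [Matrix.single_apply, jordan, Matrix.of_apply, finLast, Fin.ext_iff]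
  have := j.2
  split_ifs with h1 h2
  · omega
  all_goals simp

end FiniteMatrixRing

/-! ### Transfer of null polynomials forces the radical to vanish -/

section NullPolynomials

variable {C : Type*} [Ring C]

/-- If `c • ψ` is null for some nonzero `c : C` and an integer polynomial `ψ`, then `ψ` is null. -/
def HasNullTransfer (C : Type*) [Ring C] : Prop :=
  ∀ (ψ : ℤ[X]) (c : C), c ≠ 0 → (∀ a : C, c * Polynomial.aeval a ψ = 0) →
    ∀ a : C, Polynomial.aeval a ψ = 0

theorem HasNullTransfer.congr {C' : Type*} [Ring C'] (h : HasNullTransfer C) (e : C ≃+* C') :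
    HasNullTransfer C' := by
  intro ψ c hc hψ a
  have h1 : ∀ x : C', e.symm (Polynomial.aeval x ψ) = Polynomial.aeval (e.symm x) ψ := fun x =>
    (Polynomial.aeval_algHom_apply (e.symm : C' →+* C).toIntAlgHom x ψ).symm
  refine e.symm.injective ?_
  rw [h1, map_zero]
  refine h ψ (e.symm c) (by simpa using hc) (fun b => ?_) _
  have := congrArg e.symm (hψ (e b))
  simpa [h1] using this

/-- In the expansion of (a + y)^(s+1), words with two letters y vanish, and after left
multiplication by f so do those where a letter a precedes y. Only y a^s survives. -/
theorem add_pow_sub_pow_aux {a f y : C} (hfy : ∀ b, f * a * b * y = 0)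
    (hyy : ∀ b, y * b * y = 0) (s : ℕ) :
    f * ((a + y) ^ (s + 1) - a ^ (s + 1)) = f * y * a ^ s := by
  have h2 : ∀ s : ℕ, f * a * (a + y) ^ s = f * a * a ^ s := by
    intro s
    induction s with
    | zero => simp
    | succ s ih => rw [pow_succ, ← mul_assoc, ih, mul_add, hfy, add_zero, pow_succ, mul_assoc]
  have h3 : ∀ s : ℕ, y * (a + y) ^ s = y * a ^ s := by
    intro s
    induction s with
    | zero => simp
    | succ s ih => rw [pow_succ, ← mul_assoc, ih, mul_add, hyy, add_zero, pow_succ, mul_assoc]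
  rw [mul_sub, pow_succ', add_mul, mul_add, h3, ← mul_assoc, h2, pow_succ', ← mul_assoc, ← mul_assoc]
  abel

/-- Any nonzero element of the last nonzero power of J works; that power is at least the first
because J ≠ 0. -/
theorem exists_ne_zero_annihilator {J : Ideal C} [J.IsTwoSided] (hJ : IsNilpotent J) (hJ0 : J ≠ ⊥) :
    ∃ y ∈ J, y ≠ 0 ∧ ∀ j ∈ J, y * j = 0 ∧ j * y = 0 := by
  classical
  obtain ⟨l, hm, hne⟩ : ∃ l, J ^ (l + 1) = ⊥ ∧ J ^ l ≠ ⊥ := by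
    have h0 : Nat.find hJ ≠ 0 := fun h => by
      have h1 := Nat.find_spec hJ
      rw [h, Submodule.pow_zero, Ideal.one_eq_top] at h1
      exact hJ0 (eq_bot_iff.2 (le_top.trans h1.le))
    obtain ⟨l, hl⟩ := Nat.exists_eq_succ_of_ne_zero h0
    refine ⟨l, ?_, fun h => ?_⟩
    · have := Nat.find_spec hJ
      rwa [hl] at this
    · have := Nat.find_min' hJ h
      omega
  obtain ⟨y, hy, hy0⟩ := Submodule.exists_mem_ne_zero_of_ne_bot hne
  refine ⟨y, ?_, hy0, fun j hj => ⟨?_, ?_⟩⟩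
  · obtain ⟨i, rfl⟩ : ∃ i, l = i + 1 := by
      refine Nat.exists_eq_succ_of_ne_zero fun h => hJ0 ?_
      rwa [h, zero_add, Submodule.pow_one] at hm
    rw [Submodule.pow_succ] at hy
    exact Ideal.mul_le_right hy
  · have := Ideal.mul_mem_mul hy hj
    rw [← Submodule.pow_succ, hm] at this
    exact this
  · have := Ideal.mul_mem_mul hj hy
    rw [← Ideal.IsTwoSided.pow_succ, hm] at this
    exact this

/-- If J ≠ 0, some nonzero y₀e_i is killed by J, and multiplying by it makes X^(d+N) - X^d null as
soon as it is null on the i-th factor. Transfer makes it null on all of C. Comparing (a + y)^d with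
(a + y)^(d+N), for a lift a of the Jordan block and y annihilated by J, then forces y₀e_i = 0. -/
theorem eq_bot_of_hasNullTransfer (h : HasNullTransfer C) {J : Ideal C} [J.IsTwoSided]
    (hJ : IsNilpotent J) {ι : Type*} [Fintype ι] [DecidableEq ι] (d : ι → ℕ) [∀ i, NeZero (d i)]
    (F : ι → Type*) [∀ i, Field (F i)] [∀ i, Finite (F i)]
    (q : C →+* ∀ i, Matrix (Fin (d i)) (Fin (d i)) (F i)) (hq : Function.Surjective q)
    (hker : ∀ x, q x = 0 ↔ x ∈ J) : J = ⊥ := by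
  by_contra hJ0
  obtain ⟨y₀, hy₀J, hy₀, hy₀'⟩ := exists_ne_zero_annihilator hJ hJ0
  let V : Set C := {y | y ∈ J ∧ ∀ j ∈ J, y * j = 0 ∧ j * y = 0}
  have hVr : ∀ y ∈ V, ∀ u, y * u ∈ V := fun y hy u => ⟨J.mul_mem_right u hy.1, fun j hj =>
    ⟨by rw [mul_assoc, (hy.2 _ (J.mul_mem_left u hj)).1],
      by rw [← mul_assoc, (hy.2 j hj).2, zero_mul]⟩⟩
  have hVl : ∀ y ∈ V, ∀ u, u * y ∈ V := fun y hy u => ⟨J.mul_mem_left u hy.1, fun j hj =>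
    ⟨by rw [mul_assoc, (hy.2 j hj).1, mul_zero],
      by rw [← mul_assoc, (hy.2 _ (J.mul_mem_right u hj)).2]⟩⟩
  have hVq : ∀ y ∈ V, ∀ u u', q u = q u' → y * u = y * u' := fun y hy u u' hu => by
    rw [← sub_eq_zero, ← mul_sub, (hy.2 _ ((hker _).1 (by rw [map_sub, hu, sub_self]))).1]
  have hVq' : ∀ y ∈ V, ∀ u u', q u = q u' → u * y = u' * y := fun y hy u u' hu => by
    rw [← sub_eq_zero, ← sub_mul, (hy.2 _ ((hker _).1 (by rw [map_sub, hu, sub_self]))).2]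
  choose r hr using hq
  have hy₀V : y₀ ∈ V := ⟨hy₀J, hy₀'⟩
  obtain ⟨i, hi⟩ : ∃ i, y₀ * r (Pi.single i 1) ≠ 0 := by
    by_contra! hall
    refine hy₀ ?_
    have := hVq y₀ hy₀V 1 (∑ i, r (Pi.single i 1)) (by
      rw [map_sum, map_one]
      simp_rw [hr]
      exact (Finset.univ_sum_single 1).symm)
    rw [mul_one, Finset.mul_sum] at this
    rw [this, Finset.sum_eq_zero fun i _ => hall i]
  obtain ⟨N, hN, hpow⟩ := exists_pow_add_eq_pow (F i) (d i)
  have hnull : ∀ a : C, a ^ (d i + N) = a ^ d i := by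
    intro a
    have := h (Polynomial.X ^ (d i + N) - Polynomial.X ^ d i) _ hi (fun a => by
      rw [mul_assoc]
      refine (hy₀' _ ((hker _).1 ?_)).1
      simp only [map_sub, map_mul, map_pow, Polynomial.aeval_X, hr]
      rw [← Pi.single_mul_left]
      simp [hpow]) a
    simpa [sub_eq_zero] using this
  let S : Matrix (Fin (d i)) (Fin (d i)) (F i) → C := fun x => r (Pi.single i x)
  have hS : ∀ x, q (S x) = Pi.single i x := fun x => hr _
  set a := S (jordan (d i) (F i)) with ha
  have hd : 0 < d i := Nat.pos_of_ne_zero (NeZero.ne _)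
  have hpowS : ∀ k, 0 < k → q (a ^ k) = Pi.single i (jordan (d i) (F i) ^ k) := fun k hk => by
    obtain ⟨k, rfl⟩ := Nat.exists_eq_add_of_lt hk
    rw [zero_add]
    induction k with
    | zero => simp [hS, ha]
    | succ k ih => rw [pow_succ, map_mul, ih (by omega), ha, hS, ← Pi.single_mul, ← pow_succ]
  have hfy : ∀ f, f * a ∈ J → ∀ y ∈ V, f * y * a ^ (d i - 1) = 0 := by
    intro f hf y hy
    have e := add_pow_sub_pow_aux (a := a) (f := f) (y := y)
      (fun b => (hy.2 _ (J.mul_mem_right b hf)).2) (fun b => ((hVr y hy b).2 y hy.1).1)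
    have e1 := e (d i - 1)
    have e2 := e (d i + N - 1)
    rw [Nat.sub_add_cancel hd] at e1
    -- Since N ≥ 1 the exponent is at least d, and a^d ∈ J is killed by y.
    have e3 : f * y * a ^ (d i + N - 1) = 0 := by
      rw [show d i + N - 1 = d i + (N - 1) by omega, pow_add, mul_assoc f, ← mul_assoc y,
        (hy.2 _ ((hker _).1 (by rw [hpowS _ hd, jordan_pow_self, Pi.single_zero]))).1, zero_mul,
        mul_zero]
    rw [Nat.sub_add_cancel (by omega), hnull, hnull, e1, e3] at e2
    exact e2
  have hzero : ∀ z ∈ V, z * a ^ (d i - 1) = 0 := by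
    intro z hz
    -- Modulo J, 1 = (1 - e_i) + Σ E_(p,last) E_(last,p). Both 1 - e_i and each E_(p,last) kill the
    -- Jordan block on the left, so each is an admissible f.
    have h1 := hVq' _ (hVr z hz (a ^ (d i - 1))) 1 (r (1 - Pi.single i 1) +
      ∑ p, S (Matrix.single p (finLast (d i)) 1) * S (Matrix.single (finLast (d i)) p 1)) (by
        rw [map_add, map_one, map_sum, hr]
        simp_rw [map_mul, hS, ← Pi.single_mul, Matrix.single_mul_single_same, mul_one]
        have : ∑ p, Pi.single i (Matrix.single p p (1 : F i)) =
            (Pi.single i 1 : ∀ i, Matrix (Fin (d i)) (Fin (d i)) (F i)) := by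
          rw [← Matrix.sum_single_one]
          exact (map_sum (AddMonoidHom.single
            (fun i => Matrix (Fin (d i)) (Fin (d i)) (F i)) i) _ _).symm
        rw [this, sub_add_cancel])
    rw [one_mul, add_mul, Finset.sum_mul] at h1
    rw [h1, ← mul_assoc, hfy _ ((hker _).1 (by
      rw [map_mul, hr, ha, hS, sub_mul, one_mul, ← Pi.single_mul, one_mul, sub_self])) z hz,
      zero_add]
    refine Finset.sum_eq_zero fun p _ => ?_
    rw [mul_assoc, ← mul_assoc (S _) z, ← mul_assoc]
    exact hfy _ ((hker _).1 (by
      rw [map_mul, ha, hS, hS, ← Pi.single_mul, single_last_mul_jordan, Pi.single_zero])) _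
      (hVl z hz _)
  refine hi ?_
  -- For d = 1 the power a^0 is 1 rather than a lift of e_i, so this case is separate. Otherwise
  -- a^(d-1) lifts the corner matrix unit, from which e_i is rebuilt.
  by_cases hd1 : d i = 1
  · have := hzero y₀ hy₀V
    rw [hd1, Nat.sub_self, pow_zero, mul_one] at this
    exact absurd this hy₀
  rw [hVq y₀ hy₀V _ (∑ p, S (Matrix.single p 0 1) * a ^ (d i - 1) *
    S (Matrix.single (finLast (d i)) p 1)) (by
      rw [map_sum, hr]
      simp_rw [map_mul, hS, hpowS (d i - 1) (by omega), jordan_pow_pred, ← Pi.single_mul,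
        Matrix.single_mul_single_same, mul_one]
      rw [← Matrix.sum_single_one]
      exact map_sum (AddMonoidHom.single
        (fun i => Matrix (Fin (d i)) (Fin (d i)) (F i)) i) _ _), Finset.mul_sum]
  refine Finset.sum_eq_zero fun p _ => ?_
  rw [← mul_assoc, ← mul_assoc, hzero _ (hVr y₀ hy₀V _), zero_mul]

end NullPolynomials

/-! ### Transfer between simple factors: equal sizes and equal fields -/

section Products

open Polynomial

/-- The integer polynomial `∏_{r = 1}^n (X ^ (q ^ r) - X)`. -/
noncomputable def frobProd (q n : ℕ) : ℤ[X] := ∏ r ∈ Finset.Icc 1 n, (X ^ q ^ r - X)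

/-- An irreducible factor of degree r divides X^(q^r) - X. There are at most deg p factors with
multiplicity, which accounts for the exponent. -/
theorem dvd_frobProd_pow (F : Type*) [Field F] [Finite F] {n : ℕ} (p : F[X]) (hp : p ≠ 0)
    (hn : p.natDegree ≤ n) :
    p ∣ (frobProd (Nat.card F) n).map (Int.castRingHom F) ^ p.natDegree := by
  induction p using WfDvdMonoid.induction_on_irreducible with
  | zero => exact absurd rfl hp
  | unit u hu => exact hu.dvd
  | mul a f ha hf ih =>
    rw [natDegree_mul hf.ne_zero ha] at hn ⊢
    rw [pow_add]
    refine mul_dvd_mul ?_ (ih ha (by omega))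
    have hpos : 0 < f.natDegree := hf.natDegree_pos
    refine dvd_pow ?_ hpos.ne'
    rw [frobProd, Polynomial.map_prod]
    refine (hf.natDegree_dvd_iff_dvd_X_pow_card_pow_sub_X.1 dvd_rfl).trans ?_
    have := Finset.dvd_prod_of_mem
      (fun r => ((X : ℤ[X]) ^ Nat.card F ^ r - X).map (Int.castRingHom F))
      (Finset.mem_Icc.2 ⟨hpos, (by omega : f.natDegree ≤ n)⟩)
    simpa using this

theorem aeval_frobProd_pow_eq_zero (F : Type*) [Field F] [Finite F] (n : ℕ)
    (a : Matrix (Fin n) (Fin n) F) : aeval a (frobProd (Nat.card F) n ^ n) = 0 := by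
  have hd : a.charpoly.natDegree = n := by
    rw [Matrix.charpoly_natDegree_eq_dim, Fintype.card_fin]
  obtain ⟨r, hr⟩ := dvd_frobProd_pow F (n := n) a.charpoly a.charpoly_monic.ne_zero hd.le
  rw [hd, ← Polynomial.map_pow] at hr
  have := aeval_map_algebraMap F a (frobProd (Nat.card F) n ^ n)
  rw [← this, show algebraMap ℤ F = Int.castRingHom F from rfl, hr, map_mul,
    Matrix.aeval_self_charpoly, zero_mul]

/-- The extension L of F of degree n embeds in the n × n matrices. A generator of Lˣ is a root of
some X^(q^r) - X with r ≤ n, hence so is all of L, and |F|^n = |L| ≤ q^n. -/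
theorem card_le_of_aeval_frobProd (F : Type*) [Field F] [Finite F] (n : ℕ) [NeZero n] (q : ℕ)
    (hq : 1 < q)
    (h : ∀ a : Matrix (Fin n) (Fin n) F, aeval a (frobProd q n ^ n) = 0) : Nat.card F ≤ q := by
  classical
  obtain ⟨p, hp⟩ := CharP.exists F
  have hpp : Fact p.Prime := ⟨(CharP.char_is_prime_or_zero F p).resolve_right
    (CharP.char_ne_zero_of_finite F p)⟩
  let L := FiniteField.Extension F p n
  let b : Module.Basis (Fin n) F L :=
    Module.finBasisOfFinrankEq F L (FiniteField.finrank_extension F p n)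
  obtain ⟨ζ, hζ⟩ := IsCyclic.exists_generator (α := Lˣ)
  have h0 : aeval (ζ : L) (frobProd q n ^ n) = 0 := by
    have h1 := h (Algebra.leftMulMatrix b (ζ : L))
    have h2 := aeval_algHom_apply ((Algebra.leftMulMatrix b).toRingHom.toIntAlgHom) (ζ : L)
      (frobProd q n ^ n)
    refine Algebra.leftMulMatrix_injective b ?_
    rw [map_zero, ← h1]
    exact h2.symm
  rw [map_pow, frobProd, map_prod] at h0
  obtain ⟨r, hr, hr0⟩ := Finset.prod_eq_zero_iff.1 (pow_eq_zero_iff (NeZero.ne n) |>.1 h0)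
  rw [map_sub, map_pow, aeval_X, sub_eq_zero] at hr0
  have hroot : ∀ x : L, x ^ q ^ r = x := by
    intro x
    by_cases hx : x = 0
    · rw [hx, zero_pow (pow_pos (by omega) _).ne']
    · have := hζ (Units.mk0 x hx)
      rw [← mem_powers_iff_mem_zpowers] at this
      obtain ⟨m, hm⟩ := this
      have hm' : x = (ζ : L) ^ m := by simpa using (congrArg Units.val hm).symm
      rw [hm', ← pow_mul, mul_comm, pow_mul, hr0]
  rw [Finset.mem_Icc] at hr
  have hqr : 1 < q ^ r := Nat.one_lt_pow (by omega) hq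
  have hcard : Nat.card L ≤ q ^ r := by
    have hne : (X ^ q ^ r - X : L[X]) ≠ 0 := FiniteField.X_pow_card_sub_X_ne_zero L hqr
    have hfin := Fintype.ofFinite L
    have h1 : (Finset.univ : Finset L).val ⊆ (X ^ q ^ r - X : L[X]).roots := fun x _ => by
      rw [mem_roots hne]
      simp [hroot]
    have h2 := Polynomial.card_roots' (X ^ q ^ r - X : L[X])
    rw [FiniteField.X_pow_card_sub_X_natDegree_eq L hqr] at h2
    rw [Nat.card_eq_fintype_card, ← Finset.card_univ]
    exact (Multiset.card_le_card ((Multiset.le_iff_subset Finset.univ.nodup).2 h1)).trans h2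
  rw [FiniteField.natCard_extension] at hcard
  exact (Nat.pow_le_pow_iff_left (NeZero.ne n)).1 (hcard.trans (Nat.pow_le_pow_right (by omega) hr.2))

/-- Multiplication by the idempotent of factor i makes ψ null on the product. -/
theorem HasNullTransfer.pi {ι : Type*} [Fintype ι] {M : ι → Type*} [∀ i, Ring (M i)]
    (h : HasNullTransfer (∀ i, M i)) (i j : ι) [Nontrivial (M i)] (ψ : ℤ[X])
    (hψ : ∀ a : M i, aeval a ψ = 0) (a : M j) : aeval a ψ = 0 := by
  classical
  have hev : ∀ (l : ι) (x : ∀ i, M i),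
      @aeval ℤ (∀ i, M i) _ _ (Ring.toIntAlgebra _) x ψ l = aeval (x l) ψ := fun l x =>
    (aeval_algHom_apply ((Pi.evalRingHom M l).toIntAlgHom) x ψ).symm
  have := h ψ (Pi.single i 1) (by simp [Pi.single_eq_zero_iff]) (fun x => by
    rw [← Pi.single_mul_left, hev, hψ, mul_zero, Pi.single_zero]) (Pi.single j a)
  have := congrFun this j
  rwa [hev, Pi.single_eq_same] at this

/-- X^(d_i+N) - X^(d_i) is null on factor i, hence on factor j. Iterating this periodicity on the
nilpotent Jordan block of size d_j shows that its d_i-th power is zero. -/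
theorem size_le_of_hasNullTransfer {ι : Type*} [Fintype ι] (d : ι → ℕ) [∀ i, NeZero (d i)]
    (F : ι → Type*) [∀ i, Field (F i)] [∀ i, Finite (F i)]
    (h : HasNullTransfer (∀ i, Matrix (Fin (d i)) (Fin (d i)) (F i))) (i j : ι) : d j ≤ d i := by
  obtain ⟨N, hN, hpow⟩ := exists_pow_add_eq_pow (F i) (d i)
  have h1 := h.pi i j (X ^ (d i + N) - X ^ d i) (fun a => by simp [hpow]) (jordan (d j) (F j))
  simp only [map_sub, map_pow, aeval_X, sub_eq_zero] at h1
  have h2 : ∀ k, jordan (d j) (F j) ^ (d i + N * k) = jordan (d j) (F j) ^ d i := by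
    intro k
    induction k with
    | zero => simp
    | succ k ih => rw [mul_add, mul_one, ← add_assoc, add_right_comm, pow_add, h1, ← pow_add, ih]
  by_contra! hlt
  refine jordan_pow_ne_zero (F j) hlt ?_
  obtain ⟨m, hm⟩ := Nat.exists_eq_add_of_le (Nat.le_mul_of_pos_left (d j) hN)
  rw [← h2 (d j), hm, pow_add, pow_add, jordan_pow_self, zero_mul, mul_zero]

end Products

/-! ### Structure of finite algebras in which null polynomials transfer -/

section Structure

/-- Both fields are extensions of R/(π); equal cardinality gives equal degree, hence an embedding,
which is bijective by counting. -/
theorem nonempty_algEquiv_of_card_eq {R : Type*} [CommRing R] {π : R}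
    [hπ : (Ideal.span {π}).IsMaximal] (F F' : Type*) [Field F] [Finite F] [Algebra R F] [Field F']
    [Finite F'] [Algebra R F'] (hF : algebraMap R F π = 0) (hF' : algebraMap R F' π = 0)
    (hc : Nat.card F = Nat.card F') : Nonempty (F ≃ₐ[R] F') := by
  let k := R ⧸ Ideal.span {π}
  let _ : Field k := Ideal.Quotient.field _
  let _ : Algebra k F := (Ideal.Quotient.lift (Ideal.span {π}) (algebraMap R F) fun a ha => by
    obtain ⟨c, rfl⟩ := Ideal.mem_span_singleton'.1 ha
    rw [map_mul, hF, mul_zero]).toAlgebra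
  let _ : Algebra k F' := (Ideal.Quotient.lift (Ideal.span {π}) (algebraMap R F') fun a ha => by
    obtain ⟨c, rfl⟩ := Ideal.mem_span_singleton'.1 ha
    rw [map_mul, hF', mul_zero]).toAlgebra
  have _ : IsScalarTower R k F := IsScalarTower.of_algebraMap_eq fun r => rfl
  have _ : IsScalarTower R k F' := IsScalarTower.of_algebraMap_eq fun r => rfl
  have : Finite k := Finite.of_injective _ (algebraMap k F).injective
  have hk : Module.finrank k F = Module.finrank k F' := by
    rw [Module.natCard_eq_pow_finrank (K := k), Module.natCard_eq_pow_finrank (K := k) (V := F')] at hc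
    exact Nat.pow_right_injective (Finite.one_lt_card : 2 ≤ Nat.card k) hc
  obtain ⟨f⟩ := FiniteField.nonempty_algHom_of_finrank_dvd (F := k) (K := F) (L := F') hk.dvd
  have hb : Function.Bijective f :=
    (Nat.bijective_iff_injective_and_card _).2 ⟨f.injective, hc⟩
  exact ⟨(AlgEquiv.ofBijective f hb).restrictScalars R⟩

theorem isSemisimpleRing_of_hasNullTransfer (C : Type*) [Ring C] [Finite C]
    (h : HasNullTransfer C) : IsSemisimpleRing C := by
  classical
  rw [IsArtinianRing.isSemisimpleRing_iff_jacobson]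
  have hsp : IsSemiprimaryRing C := inferInstance
  have := hsp.isSemisimpleRing
  obtain ⟨t, F, d, _, hd, ⟨e⟩⟩ :=
    IsSemisimpleRing.exists_ringEquiv_pi_matrix_divisionRing (C ⧸ Ring.jacobson C)
  have hfin : ∀ i, Finite (F i) := fun i => by
    have : Finite (C ⧸ Ring.jacobson C) :=
      Finite.of_surjective _ (Ideal.Quotient.mk_surjective (I := Ring.jacobson C))
    refine Finite.of_surjective (fun x => e x i 0 0) fun y => ?_
    obtain ⟨x, hx⟩ := e.surjective (fun i => Matrix.of fun _ _ =>
      if h : _ = i then h ▸ y else 0)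
    exact ⟨x, by simp [hx]⟩
  refine eq_bot_of_hasNullTransfer h hsp.isNilpotent d F
    (e.toRingHom.comp (Ideal.Quotient.mk (Ring.jacobson C))) (e.surjective.comp Ideal.Quotient.mk_surjective)
    fun x => ?_
  rw [RingHom.comp_apply, ← Ideal.Quotient.eq_zero_iff_mem]
  exact map_eq_zero_iff e e.injective

/-- A finite algebra in which null polynomials transfer is a power of a full matrix algebra over a
finite field. -/
theorem exists_algEquiv_pi_matrix {R : Type*} [CommRing R] {π : R}
    [hπ : (Ideal.span {π}).IsMaximal] (C : Type v) [Ring C] [Finite C] [Nontrivial C] [Algebra R C]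
    (hC : algebraMap R C π = 0) (h : HasNullTransfer C) :
    ∃ (t n : ℕ) (F : Type v) (_ : Field F) (_ : Finite F) (_ : Algebra R F), 0 < t ∧ 0 < n ∧
      algebraMap R F π = 0 ∧ Nonempty (C ≃ₐ[R] (Fin t → Matrix (Fin n) (Fin n) F)) := by
  classical
  have := isSemisimpleRing_of_hasNullTransfer C h
  obtain ⟨t, F, d, _, _, hd, ⟨e⟩⟩ :=
    IsSemisimpleRing.exists_algEquiv_pi_matrix_divisionRing R C
  have hfin : ∀ i, Finite (F i) := fun i => by
    refine Finite.of_surjective (fun x => e x i 0 0) fun y => ?_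
    obtain ⟨x, hx⟩ := e.surjective (fun i => Matrix.of fun _ _ =>
      if h : _ = i then h ▸ y else 0)
    exact ⟨x, by simp [hx]⟩
  have hF : ∀ i, algebraMap R (F i) π = 0 := fun i => by
    have h1 := congrArg (fun x => x i 0 0) (e.commutes π)
    rw [hC, map_zero] at h1
    simpa [Matrix.algebraMap_matrix_apply] using h1.symm
  have h' := h.congr e.toRingEquiv
  have ht : 0 < t := by
    rcases Nat.eq_zero_or_pos t with rfl | ht
    · exact absurd e.toEquiv.subsingleton (not_subsingleton C)
    · exact ht
  let i₀ : Fin t := ⟨0, ht⟩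
  have hdim : ∀ i, d i = d i₀ := fun i =>
    le_antisymm (size_le_of_hasNullTransfer d F h' i₀ i) (size_le_of_hasNullTransfer d F h' i i₀)
  have hcard' : ∀ i j, Nat.card (F j) ≤ Nat.card (F i) := fun i j => by
    refine card_le_of_aeval_frobProd (F j) (d j) (Nat.card (F i)) Finite.one_lt_card fun a => ?_
    refine h'.pi i j _ (fun b => ?_) a
    rw [show d j = d i from (hdim j).trans (hdim i).symm]
    exact aeval_frobProd_pow_eq_zero (F i) (d i) b
  have hF' : ∀ i, Nonempty (F i ≃ₐ[R] F i₀) := fun i =>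
    nonempty_algEquiv_of_card_eq (F i) (F i₀) (hF i) (hF i₀)
      (le_antisymm (hcard' i₀ i) (hcard' i i₀))
  exact ⟨t, d i₀, F i₀, inferInstance, inferInstance, inferInstance, ht,
    Nat.pos_of_ne_zero (NeZero.ne _), hF i₀, ⟨e.trans (AlgEquiv.piCongrRight fun i =>
      (Matrix.reindexAlgEquiv R (F i) (finCongr (hdim i))).trans (hF' i).some.mapMatrix)⟩⟩

end Structure

/-! ### The map Φ: injectivity, functionals on coefficients, denominators -/

section IntegerValued

open Polynomial

variable {D : Type u} [CommRing D] {K : Type w} [Field K] [Algebra D K]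
  {A : Type v} [Ring A] [Algebra D A]

theorem Phi_tmul (f : IntK D K A) (a : A) :
    (Phi D K A (f ⊗ₜ a)).1 = coeffMap D K A f.1 * C (ofA D K A a) := by
  simp [Phi]

theorem coeff_Phi_tmul (f : IntK D K A) (a : A) (n : ℕ) :
    (Phi D K A (f ⊗ₜ a)).1.coeff n = f.1.coeff n ⊗ₜ a := by
  rw [Phi_tmul, coeff_mul_C]
  simp [coeff_map]

theorem coeffMap_eq_map (g : K[X]) : coeffMap D K A g =
    g.map ((Algebra.TensorProduct.includeLeft : K →ₐ[D] Ext D K A) : K →+* Ext D K A) := rfl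

theorem coeff_coeffMap (g : K[X]) (n : ℕ) : (coeffMap D K A g).coeff n = g.coeff n ⊗ₜ 1 := by
  rw [coeffMap_eq_map, coeff_map]
  rfl

theorem eval_coeffMap_map (g : D[X]) (a : A) :
    (coeffMap D K A (g.map (algebraMap D K))).eval (ofA D K A a) = ofA D K A (aeval a g) := by
  rw [← aeval_algHom_apply, coeffMap_eq_map, Polynomial.map_map]
  have : (((Algebra.TensorProduct.includeLeft : K →ₐ[D] Ext D K A) : K →+* Ext D K A).comp
      (algebraMap D K)) = algebraMap D (Ext D K A) :=
    (Algebra.TensorProduct.includeLeft : K →ₐ[D] Ext D K A).comp_algebraMap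
  rw [this, eval_map_algebraMap]

theorem eval_map_ofA (h : A[X]) (a : A) :
    (h.map (ofA D K A : A →+* Ext D K A)).eval (ofA D K A a) = ofA D K A (h.eval a) :=
  eval_map_apply (ofA D K A : A →+* Ext D K A) a

theorem X_pow_mem_IntK (n : ℕ) : (X ^ n : K[X]) ∈ IntK D K A := fun a =>
  ⟨a ^ n, by simpa using eval_coeffMap_map (K := K) (X ^ n) a⟩

theorem map_ofA_mem_range (h : A[X]) (f : IntA D K A) (hf : f.1 = h.map (ofA D K A : A →+* Ext D K A)) :
    f ∈ LinearMap.range (Phi D K A) := by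
  induction h using Polynomial.induction_on' generalizing f with
  | add p q hp hq =>
    have hmem : ∀ p : A[X], p.map (ofA D K A : A →+* Ext D K A) ∈ IntA D K A := fun p a =>
      ⟨p.eval a, eval_map_ofA p a⟩
    have : f = ⟨_, hmem p⟩ + ⟨_, hmem q⟩ := Subtype.ext (by rw [hf, Polynomial.map_add]; rfl)
    rw [this]
    exact add_mem (hp _ rfl) (hq _ rfl)
  | monomial n a =>
    refine ⟨⟨X ^ n, X_pow_mem_IntK n⟩ ⊗ₜ a, Subtype.ext ?_⟩
    ext i
    rw [coeff_Phi_tmul, hf, map_monomial, coeff_monomial, coeff_X_pow]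
    simp only [eq_comm (a := i)]
    split_ifs <;> simp

/-- The map `K[X] ⊗ A → (K ⊗ A)[X]`, `f ⊗ a ↦ f a`, detects zero coefficientwise. -/
theorem eq_zero_of_rTensor_lcoeff (z : K[X] ⊗[D] A)
    (hz : ∀ n, ((lcoeff K n).restrictScalars D).rTensor A z = 0) : z = 0 := by
  have key : ∀ z : K[X] ⊗[D] A, ∃ N₀, ∀ N ≥ N₀, z = ∑ n ∈ Finset.range N,
      ((monomial n : K →ₗ[K] K[X]).restrictScalars D).rTensor A
        (((lcoeff K n).restrictScalars D).rTensor A z) := by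
    intro z
    induction z with
    | zero => exact ⟨0, fun N _ => by simp⟩
    | tmul f a =>
      refine ⟨f.natDegree + 1, fun N hN => ?_⟩
      conv_lhs => rw [f.as_sum_range' N (by omega), TensorProduct.sum_tmul]
      rfl
    | add x y hx hy =>
      obtain ⟨M, hM⟩ := hx
      obtain ⟨N, hN⟩ := hy
      refine ⟨max M N, fun L hL => ?_⟩
      simp only [map_add, Finset.sum_add_distrib]
      rw [← hM L (le_trans (le_max_left _ _) hL), ← hN L (le_trans (le_max_right _ _) hL)]
  obtain ⟨N, hN⟩ := key z
  rw [hN N le_rfl]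
  exact Finset.sum_eq_zero fun n _ => by rw [hz, map_zero]

/-- Flatness embeds Int_K(A) ⊗ A in K[X] ⊗ A, where vanishing can be tested on coefficients. -/
theorem Phi_injective [Module.Flat D A] : Function.Injective (Phi D K A) := by
  rw [injective_iff_map_eq_zero]
  intro z hz
  have h1 := Module.Flat.rTensor_preserves_injective_linearMap (M := A) (IntK D K A).subtype
    Subtype.val_injective
  refine h1 ?_
  rw [map_zero]
  refine eq_zero_of_rTensor_lcoeff _ fun n => ?_
  have : ∀ z : IntK D K A ⊗[D] A, ((lcoeff K n).restrictScalars D).rTensor A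
      ((IntK D K A).subtype.rTensor A z) = (Phi D K A z).1.coeff n := by
    intro z
    induction z with
    | zero => simp
    | tmul f a => rw [coeff_Phi_tmul]; rfl
    | add x y hx hy => rw [map_add, map_add, hx, hy, map_add, Submodule.coe_add, coeff_add]
  rw [this, hz]
  rfl

/-- Applying l to coefficients sends Φ(f ⊗ a) = fa to l(a)f, so it maps the image of Φ into
Int_K(A). -/
theorem exists_coeff_eq_functional (l : A →ₗ[D] D) (z : IntK D K A ⊗[D] A) :
    ∃ g ∈ IntK D K A, ∀ n, g.coeff n =
      TensorProduct.rid D K (l.lTensor K ((Phi D K A z).1.coeff n)) := by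
  induction z with
  | zero => exact ⟨0, zero_mem _, fun n => by simp⟩
  | tmul f a =>
    refine ⟨l a • f.1, Submodule.smul_mem _ _ f.2, fun n => ?_⟩
    rw [coeff_Phi_tmul]
    simp
  | add x y hx hy =>
    obtain ⟨g, hg, hg'⟩ := hx
    obtain ⟨g', hg₂, hg₂'⟩ := hy
    refine ⟨g + g', add_mem hg hg₂, fun n => ?_⟩
    rw [map_add, Submodule.coe_add, coeff_add, coeff_add, map_add, map_add, hg', hg₂']

/-- If every functional sent c into P, the dual basis expansion of c would place it in PA. -/
theorem exists_functional_notMem [Module.Projective D A] {P : Ideal D} {c : A}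
    (hc : c ∉ powIdeal P A 1) : ∃ l : A →ₗ[D] D, l c ∉ P := by
  obtain ⟨s, hs⟩ := (Module.projective_def' (R := D) (P := A)).1 inferInstance
  by_contra! h
  refine hc ?_
  have h1 : Finsupp.linearCombination D id (s c) = c := LinearMap.congr_fun hs c
  rw [← h1, Finsupp.linearCombination_apply, Finsupp.sum]
  refine Submodule.sum_mem _ fun i _ => smul_mem_powIdeal ?_ _
  rw [pow_one]
  exact h ((Finsupp.lapply i).comp s)

variable [IsDomain D] [IsFractionRing D K]

omit [IsDomain D] in
theorem ofA_injective [Module.Flat D A] : Function.Injective (ofA D K A) :=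
  Algebra.TensorProduct.includeRight_injective (IsFractionRing.injective D K)

omit [IsDomain D] in
theorem div_tmul_eq {s d : D} (hd : d ≠ 0) {y b : A} (h : s • y = d • b) :
    ((algebraMap D K s / algebraMap D K d) ⊗ₜ[D] y : Ext D K A) = ofA D K A b := by
  have hd' : algebraMap D K d ≠ 0 := by simpa using hd
  have e : algebraMap D K s / algebraMap D K d = s • (algebraMap D K d)⁻¹ := by
    rw [Algebra.smul_def, div_eq_mul_inv]
  rw [e, TensorProduct.smul_tmul, h, ← TensorProduct.smul_tmul, Algebra.smul_def,
    mul_inv_cancel₀ hd']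
  rfl

omit [IsDomain D] in
/-- Null polynomials transfer in the residue rings of an `Int_K`-decomposable algebra. -/
theorem hasNullTransfer_of_isIntKDecomposable [Module.Flat D A] [Module.Projective D A]
    (hdec : IsIntKDecomposable D K A) {P : Ideal D} [hP : P.IsMaximal] {π s : D}
    (h : IsLocalUniformizer P π s) : HasNullTransfer (A ⧸ powIdeal P A 1) := by
  intro ψ c hc hψ a
  obtain ⟨c, rfl⟩ := Ideal.Quotient.mk_surjective c
  obtain ⟨a, rfl⟩ := Ideal.Quotient.mk_surjective a
  have hmk : ∀ a : A, @aeval ℤ (A ⧸ powIdeal P A 1) _ _ (Ring.toIntAlgebra _)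
      (Ideal.Quotient.mk (powIdeal P A 1) a) ψ =
      Ideal.Quotient.mk _ (aeval a ψ) := fun a =>
    aeval_algHom_apply (Ideal.Quotient.mk (powIdeal P A 1)).toIntAlgHom a ψ
  have hcψ : ∀ a : A, c * aeval a ψ ∈ powIdeal P A 1 := fun a => by
    rw [← Ideal.Quotient.eq_zero_iff_mem, map_mul, ← hmk]
    exact hψ _
  have hπ' : algebraMap D K π ≠ 0 := by simpa using h.ne_zero
  set θ : K := algebraMap D K s / algebraMap D K π with hθ
  let ψD : D[X] := ψ.map (Int.castRingHom D)
  have hψD : ∀ a : A, aeval a ψD = aeval a ψ := fun a => by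
    rw [← aeval_map_algebraMap D a ψ]
    rfl
  -- Multiplication by s turns cψ(a) ∈ PA into a multiple of π, so (s/π)cψ is integer-valued.
  let f : (Ext D K A)[X] := C (θ ⊗ₜ c) * coeffMap D K A (ψD.map (algebraMap D K))
  have hf : f ∈ IntA D K A := by
    intro a
    obtain ⟨b, hb⟩ := h.pow_smul_eq (hcψ a)
    rw [pow_one, pow_one] at hb
    refine ⟨b, ?_⟩
    rw [eval_C_mul, eval_coeffMap_map, hψD, ← div_tmul_eq (K := K) h.ne_zero hb]
    simp [hθ]
  obtain ⟨z, hz⟩ := hdec.2 ⟨f, hf⟩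
  obtain ⟨l, hl⟩ := exists_functional_notMem (P := P) (c := c)
    (fun hc' => hc (Ideal.Quotient.eq_zero_iff_mem.2 hc'))
  obtain ⟨g, hg, hgc⟩ := exists_coeff_eq_functional l z
  -- The functional turns c into the scalar l(c), so l(c)(s/π)ψ is in Int_K(A); evaluating at a and
  -- clearing l(c)s ∉ P concludes.
  have hgf : g = C (l c • θ) * ψD.map (algebraMap D K) := by
    ext n
    rw [hgc, hz, coeff_C_mul, coeff_C_mul]
    rw [coeff_coeffMap, Algebra.TensorProduct.tmul_mul_tmul, mul_one, LinearMap.lTensor_tmul,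
      TensorProduct.rid_tmul, smul_mul_assoc]
  obtain ⟨a', ha'⟩ := hg a
  have ha'' : (coeffMap D K A g).eval (ofA D K A a) = ofA D K A a' := ha'
  rw [hgf, map_mul, coeffMap_eq_map (C _), map_C, eval_C_mul, eval_coeffMap_map, hψD] at ha''
  have h2 : (l c * s) • aeval a ψ = π • a' := by
    refine ofA_injective (D := D) (K := K) ?_
    rw [map_smul, map_smul, ← ha'']
    simp only [RingHom.coe_coe, Algebra.TensorProduct.includeLeft_apply,
      Algebra.TensorProduct.includeRight_apply, Algebra.TensorProduct.tmul_mul_tmul, mul_one,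
      one_mul, TensorProduct.smul_tmul']
    congr 1
    rw [hθ]
    simp only [Algebra.smul_def, map_mul]
    field_simp
  rw [hmk, Ideal.Quotient.eq_zero_iff_mem]
  refine mem_powIdeal_of_smul_mem (s := l c * s) (fun hls => ?_) ?_
  · exact (hP.isPrime.mem_or_mem hls).elim hl h.notMem
  · rw [h2]
    exact smul_mem_powIdeal (by simpa using h.mem) a'

theorem exists_smul_eq_map_ofA (f : (Ext D K A)[X]) :
    ∃ d : D, d ≠ 0 ∧ ∃ h : A[X], d • f = h.map (ofA D K A : A →+* Ext D K A) := by
  have hB : ∀ b : Ext D K A, ∃ d : D, d ≠ 0 ∧ ∃ a, d • b = ofA D K A a := by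
    intro b
    induction b using TensorProduct.induction_on with
    | zero => exact ⟨1, one_ne_zero, 0, by simp⟩
    | tmul k a =>
      obtain ⟨r, d, hd, rfl⟩ := IsFractionRing.div_surjective (A := D) k
      refine ⟨d, nonZeroDivisors.ne_zero hd, r • a, ?_⟩
      rw [← div_tmul_eq (K := K) (s := r) (y := d • a) (nonZeroDivisors.ne_zero hd)
        (smul_comm _ _ _), ← TensorProduct.smul_tmul, TensorProduct.smul_tmul']
    | add x y hx hy =>
      obtain ⟨d, hd, a, ha⟩ := hx
      obtain ⟨e, he, b, hb⟩ := hy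
      refine ⟨d * e, mul_ne_zero hd he, e • a + d • b, ?_⟩
      rw [smul_add, map_add, map_smul, map_smul, ← ha, ← hb, smul_smul, smul_smul, mul_comm e]
  induction f using Polynomial.induction_on' with
  | add p q hp hq =>
    obtain ⟨d, hd, a, ha⟩ := hp
    obtain ⟨e, he, b, hb⟩ := hq
    refine ⟨d * e, mul_ne_zero hd he, C (algebraMap D A e) * a + C (algebraMap D A d) * b, ?_⟩
    have hsm : ∀ (r : D) (p : A[X]), (C (algebraMap D A r) * p).map
        (ofA D K A : A →+* Ext D K A) = r • p.map (ofA D K A : A →+* Ext D K A) := by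
      intro r p
      ext i
      rw [coeff_map, coeff_C_mul, coeff_smul, coeff_map, ← Algebra.smul_def]
      exact map_smul (ofA D K A) r _
    rw [smul_add, Polynomial.map_add, hsm, hsm, ← ha, ← hb, smul_smul, smul_smul, mul_comm e]
  | monomial n b =>
    obtain ⟨d, hd, a, ha⟩ := hB b
    exact ⟨d, hd, monomial n a, by rw [map_monomial, smul_monomial, ha]; rfl⟩

end IntegerValued

/-! ### From central generators of null polynomials to decomposability -/

section IntegerValued

open Polynomial

variable {D : Type u} [CommRing D] {K : Type w} [Field K] [Algebra D K]
  {A : Type v} [Ring A] [Algebra D A]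

/-- Modulo `P ^ k`, the null polynomials on `A` are generated by those with coefficients in `D`. -/
def HasCentralNullGenerators (P : Ideal D) (A : Type v) [Ring A] [Algebra D A] : Prop :=
  ∀ (k : ℕ) (h : A[X]), (∀ a, h.eval a ∈ powIdeal P A k) →
    ∃ (ι : Type) (_ : Fintype ι) (g : ι → D[X]) (c : ι → A), (∀ l a, aeval a (g l) ∈ powIdeal P A k) ∧
      ∀ i, h.coeff i - ∑ l, (g l).coeff i • c l ∈ powIdeal P A k

/-- Take k to be the exact order of d at P. Then s₀^k d = π^k r with r ∉ P for a local uniformizer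
(π, s₀), and s = r s₀^k works. -/
theorem exists_smul_eq_smul_of_mem_powIdeal [IsDedekindDomain D] {P : Ideal D} [hP : P.IsMaximal]
    (hP0 : P ≠ ⊥) {d : D} (hd : d ≠ 0) :
    ∃ k, d ∈ P ^ k ∧ ∃ s ∉ P, ∀ y ∈ powIdeal P A k, ∃ b, s • y = d • b := by
  have hex : ∃ k, d ∉ P ^ k := by
    by_contra! h
    have := Ideal.iInf_pow_eq_bot_of_isDomain P hP.ne_top
    exact hd (by rw [← Ideal.mem_bot, ← this]; exact Ideal.mem_iInf.2 h)
  classical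
  obtain ⟨k, hk, hk'⟩ : ∃ k, d ∈ P ^ k ∧ d ∉ P ^ (k + 1) := by
    have h0 : Nat.find hex ≠ 0 := fun h0 => by
      have := Nat.find_spec hex
      rw [h0] at this
      simp at this
    obtain ⟨k, hk⟩ := Nat.exists_eq_succ_of_ne_zero h0
    refine ⟨k, not_not.1 (Nat.find_min hex (by omega)), ?_⟩
    have := Nat.find_spec hex
    rwa [hk] at this
  obtain ⟨π, s, h⟩ := exists_isLocalUniformizer P hP0
  have hmem : ∀ {j : ℕ} {a : D}, a ∈ powIdeal P D j ↔ a ∈ P ^ j := fun {j a} => by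
    rw [powIdeal, Algebra.algebraMap_self, Ideal.map_id]
  obtain ⟨r, hr⟩ := h.pow_smul_eq (A := D) (hmem.2 hk)
  simp only [smul_eq_mul] at hr
  have hr' : r ∉ P := fun hrP => hk' (hmem.1 (mem_powIdeal_of_smul_mem (s := s ^ k)
    (fun hs => h.notMem (hP.isPrime.mem_of_pow_mem k hs)) (hmem.2 (by
      rw [smul_eq_mul, hr, pow_succ]
      exact Ideal.mul_mem_mul (Ideal.pow_mem_pow h.mem k) hrP))))
  refine ⟨k, hk, r * s ^ k, fun hs => (hP.isPrime.mem_or_mem hs).elim hr'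
    fun hs => h.notMem (hP.isPrime.mem_of_pow_mem k hs), fun y hy => ?_⟩
  obtain ⟨b, hb⟩ := h.pow_smul_eq hy
  exact ⟨s ^ k • b, by rw [mul_smul, hb, smul_smul, smul_smul, mul_comm d, hr, mul_comm r]⟩

theorem mem_range_Phi_of_coeff (f : IntA D K A) (hf : ∀ i, ∃ a, f.1.coeff i = ofA D K A a) :
    f ∈ LinearMap.range (Phi D K A) := by
  obtain ⟨h, hh⟩ := (mem_lifts (f := (ofA D K A : A →+* Ext D K A)) f.1).1
    ((lifts_iff_coeff_lifts _).2 fun i => by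
      obtain ⟨a, ha⟩ := hf i
      exact ⟨a, ha.symm⟩)
  exact map_ofA_mem_range h f hh.symm

variable [IsDedekindDomain D] [IsFractionRing D K] [Module.Flat D A]

/-- `A` is `Int_K`-decomposable as soon as its null polynomials modulo prime powers are generated by
central ones. -/
theorem isIntKDecomposable_of_hasCentralNullGenerators
    (hA : ∀ P : Ideal D, P.IsMaximal → P ≠ ⊥ → HasCentralNullGenerators P A) :
    IsIntKDecomposable D K A := by
  refine ⟨Phi_injective, fun f => ?_⟩
  -- I consists of the r with rf in the image of Φ; a maximal ideal P containing I is refuted by an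
  -- element of I outside P.
  let I : Ideal D := (LinearMap.range (Phi D K A)).comap (LinearMap.toSpanSingleton D _ f)
  have hI : ∀ r, r ∈ I ↔ r • f ∈ LinearMap.range (Phi D K A) := fun r => by
    simp [I]
  suffices I = ⊤ by
    have h1 : (1 : D) ∈ I := by rw [this]; trivial
    rwa [hI, one_smul] at h1
  by_contra hne
  obtain ⟨P, hP, hIP⟩ := Ideal.exists_le_maximal I hne
  obtain ⟨d, hd, h, hh⟩ := exists_smul_eq_map_ofA f.1
  have hdI : d ∈ I := (hI d).2 (map_ofA_mem_range h _ hh)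
  have hP0 : P ≠ ⊥ := fun h0 => hd (by
    have := hIP hdI
    rwa [h0, Ideal.mem_bot] at this)
  obtain ⟨k, hk, s, hs, hsd⟩ := exists_smul_eq_smul_of_mem_powIdeal (A := A) hP0 hd
  have hdK : algebraMap D K d ≠ 0 := by simpa using hd
  have heval : ∀ a, h.eval a ∈ powIdeal P A k := by
    intro a
    obtain ⟨a', ha'⟩ := f.2 a
    have : h.eval a = d • a' := by
      refine ofA_injective (D := D) (K := K) ?_
      rw [← eval_map_ofA, ← hh, eval_smul, ha', map_smul]
    rw [this]
    exact smul_mem_powIdeal hk a'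
  obtain ⟨ι, _, g, c, hg, hc⟩ := hA P hP hP0 k h heval
  -- The choice of k and s makes θ = s/d carry P^k A into A. Thus θ g_l ∈ Int_K(A), and sf differs
  -- from Σ θ g_l c_l by a polynomial over A, which lies in the image of Φ.
  set θ : K := algebraMap D K s / algebraMap D K d with hθ
  have hfl : ∀ l, C θ * (g l).map (algebraMap D K) ∈ IntK D K A := by
    intro l a
    obtain ⟨b, hb⟩ := hsd _ (hg l a)
    refine ⟨b, ?_⟩
    change (coeffMap D K A _).eval _ = _
    rw [map_mul, coeffMap_eq_map (C _), map_C, eval_C_mul, eval_coeffMap_map,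
      ← div_tmul_eq (K := K) hd hb]
    simp [hθ]
  refine hs (hIP ((hI s).2 ?_))
  obtain ⟨z, hz⟩ : ∃ z : IntK D K A ⊗[D] A, z = ∑ l, ⟨_, hfl l⟩ ⊗ₜ c l := ⟨_, rfl⟩
  have key : s • f - Phi D K A z ∈ LinearMap.range (Phi D K A) := by
    refine mem_range_Phi_of_coeff _ fun i => ?_
    obtain ⟨b, hb⟩ := hsd _ (hc i)
    refine ⟨b, ?_⟩
    have h1 : s • f.1.coeff i = (θ ⊗ₜ h.coeff i : Ext D K A) := by
      have h2 : d • f.1.coeff i = (1 ⊗ₜ h.coeff i : Ext D K A) := by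
        rw [← coeff_smul, hh, coeff_map]
        rfl
      have h3 : (θ ⊗ₜ h.coeff i : Ext D K A) = θ • (1 ⊗ₜ h.coeff i : Ext D K A) := by
        rw [TensorProduct.smul_tmul', smul_eq_mul, mul_one]
      rw [h3, ← h2, ← algebraMap_smul K d, ← algebraMap_smul K s, smul_smul, hθ,
        div_mul_cancel₀ _ hdK]
    rw [hz, map_sum, Submodule.coe_sub, Submodule.coe_smul, Submodule.coe_sum, coeff_sub, coeff_smul, h1,
      finsetSum_coeff, ← div_tmul_eq (K := K) hd hb, TensorProduct.tmul_sub,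
      TensorProduct.tmul_sum]
    congr 1
    refine Finset.sum_congr rfl fun l _ => ?_
    rw [coeff_Phi_tmul, coeff_C_mul, coeff_map, ← TensorProduct.smul_tmul, Algebra.smul_def,
      mul_comm]
  obtain ⟨z', hz'⟩ := key
  exact ⟨z' + z, by
    rw [map_add, hz']
    exact Subtype.ext (sub_add_cancel (s • f.1) (Phi D K A z).1)⟩

end IntegerValued

/-! ### Rigidity: a complete algebra is recovered from its reduction -/

section Lifting

variable {R : Type*} [CommRing R] {π : R} {C : Type*} [Ring C] [Algebra R C]

/-- A complete algebra is determined by its reduction when the latter lifts to a separable one. -/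
theorem exists_algEquiv_lift {E : Type*} [Ring E] [Algebra R E] {ι : Type*} [Fintype ι]
    [Module.Free R E] (hC : PiComplete π C) (hC' : NoTorsion π C) (hE : PiComplete π E)
    {a b : ι → E} (hab : IsSeparability R a b) {Q : Type*} [Ring Q]
    (q : C →+* Q) (hq : Function.Surjective q) (hker : ∀ x, q x = 0 ↔ x ∈ powSub π 1 C)
    (φ : E →+* Q) (hφs : Function.Surjective φ) (hφk : ∀ x, φ x = 0 → x ∈ powSub π 1 E)
    (hφ : ∀ r, φ (algebraMap R E r) = q (algebraMap R C r)) :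
    ∃ ψ : E ≃ₐ[R] C, ∀ x, q (ψ x) = φ x := by
  have hπ : q (algebraMap R C π) = 0 := by
    rw [hker, Algebra.algebraMap_eq_smul_one]
    exact smul_mem_powSub_one 1
  obtain ⟨ψ, hψ⟩ := exists_algHom_lift_of_surjective hC hC' hab q hq (fun x => (hker x).1) hπ φ hφ
  have hbij : Function.Bijective ψ := by
    refine bijective_of_bijective_mod hE hC hC' ψ.toLinearMap (fun y => ?_) fun x hx => ?_
    · obtain ⟨x, hx⟩ := hφs (q y)
      refine ⟨x, (hker _).1 ?_⟩
      rw [map_sub, AlgHom.toLinearMap_apply, hψ, hx, sub_self]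
    · exact hφk x (by rw [← hψ]; exact (hker _).2 hx)
  exact ⟨AlgEquiv.ofBijective ψ hbij, hψ⟩

theorem IsModel.exists_algEquiv {T F : Type*} [CommRing T] [Algebra R T] [Field F] [Algebra R F]
    {d : ℕ} {b : Module.Basis (Fin d) R T} {ρ : T →ₐ[R] F} {σ : Fin d → T ≃ₐ[R] T}
    (hT : IsModel π b ρ σ) (hC : PiComplete π C) (hC' : NoTorsion π C) {Q : Type*} [Ring Q]
    (q : C →+* Q) (hq : Function.Surjective q) (hker : ∀ x, q x = 0 ↔ x ∈ powSub π 1 C)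
    {t n : ℕ} (hn : 0 < n) (e : (Fin t → Matrix (Fin n) (Fin n) F) ≃+* Q)
    (he : ∀ r, e (algebraMap R _ r) = q (algebraMap R C r)) :
    Nonempty (C ≃ₐ[R] (Fin t → Matrix (Fin n) (Fin n) T)) := by
  have := hT.unramified
  have := Module.Free.of_basis b
  have := Module.Finite.of_basis b
  obtain ⟨m, x, y, hxy⟩ := exists_isSeparability R T
  let Φ : (Fin t → Matrix (Fin n) (Fin n) T) →ₐ[R] (Fin t → Matrix (Fin n) (Fin n) F) :=
    AlgHom.compLeft (ρ.mapMatrix) (Fin t)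
  have hΦ : ∀ z i r s, Φ z i r s = ρ (z i r s) := fun _ _ _ _ => rfl
  have hs : Function.Surjective Φ := fun z => by
    choose w hw using fun i r s => hT.surj (z i r s)
    exact ⟨fun i => Matrix.of fun r s => w i r s, by
      ext i r s
      exact hw i r s⟩
  have hk : ∀ z, e (Φ z) = 0 → z ∈ powSub π 1 (Fin t → Matrix (Fin n) (Fin n) T) := fun z hz => by
    have h0 : Φ z = 0 := e.injective (by rw [map_zero, hz])
    refine mem_powSub_pi.2 fun i => mem_powSub_pi.2 fun r => mem_powSub_pi.2 fun s =>
      hT.ker _ ?_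
    rw [← hΦ, h0]
    rfl
  obtain ⟨ψ, -⟩ := exists_algEquiv_lift hC hC'
    (PiComplete.pi fun _ => PiComplete.pi fun _ => PiComplete.pi fun _ => hT.complete)
    ((hxy.matrix (Fin n) ⟨0, hn⟩).pi (Fin t)) q hq hker (e.toRingHom.comp Φ.toRingHom)
    (e.surjective.comp hs) hk fun r => (congrArg e (Φ.commutes r)).trans (he r)
  exact ⟨ψ.symm⟩

end Lifting

/-! ### Decomposability determines the completions -/

section Forward

variable {D : Type u} [CommRing D] {P : Ideal D} {A : Type v} [Ring A] [Algebra D A]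

theorem finite_quotient_powIdeal_one [Module.Finite D A] [Finite (D ⧸ P)] :
    Finite (A ⧸ powIdeal P A 1) := by
  obtain ⟨m, f, hf⟩ := Module.Finite.exists_fin' D A
  refine Finite.of_surjective (α := Fin m → D ⧸ P)
    (fun c => Ideal.Quotient.mk (powIdeal P A 1) (f fun i => Quotient.out (c i))) fun x => ?_
  obtain ⟨x, rfl⟩ := Ideal.Quotient.mk_surjective x
  obtain ⟨v, rfl⟩ := hf x
  refine ⟨fun i => Ideal.Quotient.mk P (v i), Ideal.Quotient.eq.2 ?_⟩
  rw [← map_sub, LinearMap.pi_apply_eq_sum_univ f]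
  refine Submodule.sum_mem _ fun i _ => smul_mem_powIdeal ?_ _
  rw [pow_one, Pi.sub_apply, ← Ideal.Quotient.eq]
  exact Ideal.Quotient.mk_out _

variable {K : Type w} [Field K] [Algebra D K] [IsFractionRing D K]

/-- If A = PA then s·1 ∈ πA, so s/π ∈ A ∩ K = D and s ∈ P. The condition A ∩ K = D thus yields n, t
≥ 1. -/
theorem nontrivial_quotient_powIdeal_one (hA : StandardAssumptions D K A) {π s : D}
    (h : IsLocalUniformizer P π s) : Nontrivial (A ⧸ powIdeal P A 1) := by
  rw [Ideal.Quotient.nontrivial_iff, Ne, Ideal.eq_top_iff_one]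
  intro h1
  obtain ⟨b, hb⟩ := h.pow_smul_eq h1
  rw [pow_one, pow_one] at hb
  obtain ⟨d, hd⟩ := (hA.inter_eq _).1 ⟨b, div_tmul_eq (K := K) h.ne_zero hb⟩
  have hπ : algebraMap D K π ≠ 0 := by simpa using h.ne_zero
  rw [div_eq_iff hπ, ← map_mul] at hd
  refine h.notMem ?_
  rw [IsFractionRing.injective D K hd]
  exact P.mul_mem_left d h.mem

theorem exists_algEquiv_of_isIntKDecomposable [IsDedekindDomain D] [Module.Finite D A]
    (hA : StandardAssumptions D K A) (hdec : IsIntKDecomposable D K A) [P.IsPrime] (hP0 : P ≠ ⊥)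
    [Finite (D ⧸ P)] :
    ∃ (n t : ℕ) (T : Type u) (_ : CommRing T) (_ : IsDomain T) (_ : IsDiscreteValuationRing T)
      (_ : Algebra (AdicCompletion P D) T), 0 < n ∧ 0 < t ∧ IsCompleteUnramified P T ∧
      Nonempty (Compl P A ≃ₐ[AdicCompletion P D] (Fin t → Matrix (Fin n) (Fin n) T)) := by
  have := hA.torsionFree
  have hP : P.IsMaximal := Ideal.IsPrime.isMaximal ‹_› hP0
  have : Module.FinitePresentation D A := Module.finitePresentation_of_finite D A
  have : Module.Projective D A := Module.Flat.projective_of_finitePresentation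
  have hfg : P.FG := IsNoetherian.noetherian P
  obtain ⟨π, s, h⟩ := exists_isLocalUniformizer P hP0
  have := nontrivial_quotient_powIdeal_one hA h
  have := finite_quotient_powIdeal_one (P := P) (A := A)
  have := h.span_isMaximal hfg
  let q := evalCompl P A 1
  let _ : Algebra (AdicCompletion P D) (A ⧸ powIdeal P A 1) :=
    (q.comp (algebraMap (AdicCompletion P D) (Compl P A))).toAlgebra' fun c x => by
      obtain ⟨x, rfl⟩ := evalCompl_surjective 1 x
      rw [RingHom.comp_apply, ← map_mul, Algebra.commutes, map_mul]
  have hπ : algebraMap (AdicCompletion P D) (A ⧸ powIdeal P A 1) (algebraMap D _ π) = 0 := by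
    change q (algebraMap (AdicCompletion P D) (Compl P A) (algebraMap D (AdicCompletion P D) π)) = 0
    rw [algebraMap_compl, evalCompl_toCompl, Ideal.Quotient.eq_zero_iff_mem]
    exact Ideal.mem_map_of_mem _ (by simpa using h.mem)
  obtain ⟨t, n, F, _, _, _, ht, hn, hF, ⟨e⟩⟩ := exists_algEquiv_pi_matrix (A ⧸ powIdeal P A 1) hπ
    (hasNullTransfer_of_isIntKDecomposable hdec h)
  obtain ⟨T, _, _, _, _, d, b, ρ, σ, hT, hT'⟩ := exists_isModel_isCompleteUnramified h hfg F hF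
  refine ⟨n, t, T, _, _, _, _, hn, ht, hT', ?_⟩
  exact hT.exists_algEquiv (h.piComplete_compl hfg) h.noTorsion_compl q (evalCompl_surjective 1)
    (fun x => (h.mem_powSub_compl_iff hfg 1 x).symm) hn e.symm.toRingEquiv e.symm.commutes

end Forward

/-! ### Null polynomials on powers of matrix algebras -/

section NullSequences

variable {R : Type*} [CommRing R] {π : R} {C : Type*} [Ring C] [Algebra R C]

theorem pow_sub_pow_mem_powSub {k : ℕ} {x y : C} (h : x - y ∈ powSub π k C) (j : ℕ) :
    x ^ j - y ^ j ∈ powSub π k C := by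
  induction j with
  | zero => simp
  | succ j ih =>
    rw [pow_succ, pow_succ]
    exact mul_sub_mul_mem_powSub ih h

theorem smul_mem_powSub_of_left {M : Type*} [AddCommGroup M] [Module R M] {k : ℕ} {r : R}
    (hr : r ∈ powSub π k R) (x : M) : r • x ∈ powSub π k M := by
  obtain ⟨r, rfl⟩ := hr
  exact ⟨r • x, by rw [LinearMap.lsmul_apply, LinearMap.lsmul_apply, smul_smul, smul_eq_mul]⟩

variable (π) in
/-- The polynomial with coefficients `h 0, …, h (N - 1)` is null on `C` modulo `π ^ k`. -/
def IsNullSeq (k N : ℕ) (h : ℕ → C) : Prop :=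
  ∀ x : C, ∑ j ∈ Finset.range N, h j * x ^ j ∈ powSub π k C

variable {k N : ℕ} {h : ℕ → C}

/-- Since u x^j = (u x u⁻¹)^j u, the new value at x is the old value at u x u⁻¹, times u. -/
theorem IsNullSeq.mul_unit (hh : IsNullSeq π k N h) (u : Cˣ) :
    IsNullSeq π k N fun j => h j * u := by
  intro x
  have := mul_mem_powSub_right (hh (u * x * ↑u⁻¹)) u
  convert this using 1
  rw [Finset.sum_mul]
  refine Finset.sum_congr rfl fun j _ => ?_
  rw [Units.conj_pow]
  simp [mul_assoc]

theorem IsNullSeq.mul_central (hh : IsNullSeq π k N h) {z : C} (hz : ∀ x, z * x = x * z) :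
    IsNullSeq π k N fun j => h j * z := by
  intro x
  have := mul_mem_powSub_left z (hh x)
  convert this using 1
  rw [Finset.mul_sum]
  refine Finset.sum_congr rfl fun j _ => ?_
  rw [← mul_assoc, hz]

/-- z is the difference of the units 1 + z and 1. -/
theorem IsNullSeq.mul_of_sq_eq_zero (hh : IsNullSeq π k N h) {z : C} (hz : z * z = 0) :
    IsNullSeq π k N fun j => h j * z := by
  intro x
  have h1 : (1 + z) * (1 - z) = 1 := by noncomm_ring; simp [hz]
  have h2 : (1 - z) * (1 + z) = 1 := by noncomm_ring; simp [hz]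
  have := sub_mem (hh.mul_unit ⟨1 + z, 1 - z, h1, h2⟩ x) (hh x)
  rw [← Finset.sum_sub_distrib] at this
  simpa [mul_add, add_mul] using this

variable {T : Type*} [CommRing T] [Algebra R T] {t n : ℕ}

/-- Off-diagonal matrix units have square zero, and E_(a,a) = E_(a,c) E_(c,a) if c ≠ a exists.
Otherwise E_(a,a) = 1 and its copy in factor i is central. -/
theorem IsNullSeq.mul_single {h : ℕ → Fin t → Matrix (Fin n) (Fin n) T} (hh : IsNullSeq π k N h)
    (i : Fin t) (a b : Fin n) :
    IsNullSeq π k N fun j => h j * Pi.single i (Matrix.single a b 1) := by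
  have hne : ∀ {h : ℕ → Fin t → Matrix (Fin n) (Fin n) T}, IsNullSeq π k N h → ∀ {a b : Fin n},
      a ≠ b → IsNullSeq π k N fun j => h j * Pi.single i (Matrix.single a b 1) := by
    intro h hh a b hab
    refine hh.mul_of_sq_eq_zero ?_
    rw [← Pi.single_mul, Matrix.single_mul_single_of_ne _ _ _ _ hab.symm, Pi.single_zero]
  by_cases hab : a = b
  · subst hab
    by_cases hex : ∃ c, a ≠ c
    · obtain ⟨c, hc⟩ := hex
      have := hne (hne hh hc) hc.symm
      simpa only [mul_assoc, ← Pi.single_mul, Matrix.single_mul_single_same, mul_one] using this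
    · push Not at hex
      have h1 : (Matrix.single a a 1 : Matrix (Fin n) (Fin n) T) = 1 := by
        ext r s
        rw [← hex r, ← hex s]
        simp
      rw [h1]
      refine hh.mul_central fun x => ?_
      ext j : 1
      rw [Pi.mul_apply, Pi.mul_apply]
      obtain rfl | hj := eq_or_ne j i
      · simp
      · simp [hj]
  · exact hne hh hab

/-- Right multiplication of h_j by E_(b,c) in factor i moves column b to column c, so row a of the
result reads off h_j(a,b) times row c of x^j. -/
theorem IsNullSeq.entry {h : ℕ → Fin t → Matrix (Fin n) (Fin n) T} (hh : IsNullSeq π k N h)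
    (i : Fin t) (a b : Fin n) (x : Matrix (Fin n) (Fin n) T) :
    ∑ j ∈ Finset.range N, h j i a b • x ^ j ∈ powSub π k (Matrix (Fin n) (Fin n) T) := by
  refine mem_powSub_pi.2 fun c => mem_powSub_pi.2 fun r => ?_
  have h1 := mem_powSub_pi.1 (mem_powSub_pi.1
    (mem_powSub_pi.1 (hh.mul_single i b c (fun _ => x)) i) a) r
  convert h1 using 1
  rw [Finset.sum_apply, Matrix.sum_apply, Matrix.sum_apply]
  refine Finset.sum_congr rfl fun j _ => ?_
  change _ = (h j i * (Pi.single i (Matrix.single b c 1) : Fin t → Matrix (Fin n) (Fin n) T) i *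
    x ^ j) a r
  rw [Pi.single_eq_same, Matrix.mul_apply]
  rw [Finset.sum_eq_single c]
  · simp
  · intro c' _ hc'
    rw [Matrix.mul_single_apply_of_ne (hbj := hc'), zero_mul]
  · simp

/-- Applying σ_i to the value at σ_i⁻¹(x) gives Σ_l σ_i(β_l) V_l ∈ π^k, where V_l is the l-th
coordinate polynomial at x. The matrix (σ_i β_l) is invertible, so every V_l lies in π^k. -/
theorem sum_repr_smul_pow_mem {d : ℕ} (β : Module.Basis (Fin d) R T) (σ : Fin d → T ≃ₐ[R] T)
    (hdet : IsUnit (Matrix.of fun i j => σ i (β j)).det) {τ : ℕ → T}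
    (hτ : ∀ x : Matrix (Fin n) (Fin n) T, ∑ j ∈ Finset.range N, τ j • x ^ j ∈
      powSub π k (Matrix (Fin n) (Fin n) T)) (l : Fin d) (x : Matrix (Fin n) (Fin n) T) :
    ∑ j ∈ Finset.range N, β.repr (τ j) l • x ^ j ∈ powSub π k (Matrix (Fin n) (Fin n) T) := by
  set M : Matrix (Fin d) (Fin d) T := Matrix.of fun i j => σ i (β j) with hM
  set V : Fin d → Matrix (Fin n) (Fin n) T :=
    fun l => ∑ j ∈ Finset.range N, β.repr (τ j) l • x ^ j with hV
  have h1 : ∀ i, ∑ l, M i l • V l ∈ powSub π k (Matrix (Fin n) (Fin n) T) := by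
    intro i
    have h2 := map_mem_powSub (σ i).mapMatrix.toLinearMap (hτ ((σ i).symm.mapMatrix x))
    convert h2 using 1
    rw [map_sum]
    simp only [hV, Finset.smul_sum]
    rw [Finset.sum_comm]
    refine Finset.sum_congr rfl fun j _ => ?_
    have h3 : (σ i).mapMatrix ((σ i).symm.mapMatrix x) = x := by ext; simp
    have h4 : (σ i).mapMatrix (τ j • (σ i).symm.mapMatrix x ^ j) = σ i (τ j) • x ^ j := by
      conv_rhs => rw [← h3, ← map_pow]
      ext r s
      simp
    refine Eq.trans ?_ h4.symm
    conv_rhs => rw [← β.sum_repr (τ j), map_sum, Finset.sum_smul]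
    refine Finset.sum_congr rfl fun l _ => ?_
    rw [map_smul, smul_assoc, smul_comm]
    rfl
  have hsm : ∀ (c : T) {y : Matrix (Fin n) (Fin n) T}, y ∈ powSub π k (Matrix (Fin n) (Fin n) T) →
      c • y ∈ powSub π k (Matrix (Fin n) (Fin n) T) := by
    rintro c _ ⟨y, rfl⟩
    exact ⟨c • y, by simp [smul_comm c]⟩
  have h2 : V l = ∑ i, M⁻¹ l i • ∑ l, M i l • V l := by
    simp only [Finset.smul_sum, smul_smul]
    rw [Finset.sum_comm]
    simp only [← Finset.sum_smul, ← Matrix.mul_apply, Matrix.nonsing_inv_mul M hdet,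
      Matrix.one_apply, ite_smul, one_smul, zero_smul, Finset.sum_ite_eq, Finset.mem_univ, if_true]
  change V l ∈ _
  rw [h2]
  exact Submodule.sum_mem _ fun i _ => hsm _ (h1 i)

/-- Null polynomials on a power of a matrix algebra over `T` are generated by central ones. -/
theorem IsNullSeq.exists_generators {d : ℕ} (β : Module.Basis (Fin d) R T)
    (σ : Fin d → T ≃ₐ[R] T) (hdet : IsUnit (Matrix.of fun i j => σ i (β j)).det)
    {h : ℕ → Fin t → Matrix (Fin n) (Fin n) T} (hh : IsNullSeq π k N h) :
    ∃ (ι : Type) (_ : Fintype ι) (r : ι → ℕ → R) (c : ι → Fin t → Matrix (Fin n) (Fin n) T),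
      (∀ l x, ∑ j ∈ Finset.range N, r l j • x ^ j ∈
        powSub π k (Fin t → Matrix (Fin n) (Fin n) T)) ∧ ∀ j, h j = ∑ l, r l j • c l := by
  refine ⟨Fin t × Fin n × Fin n × Fin d, inferInstance, fun p j => β.repr (h j p.1 p.2.1 p.2.2.1)
    p.2.2.2, fun p => Pi.single p.1 (Matrix.single p.2.1 p.2.2.1 (β p.2.2.2)), ?_, fun j => ?_⟩
  · rintro ⟨i, a, b, l⟩ x
    refine mem_powSub_pi.2 fun i' => ?_
    have := sum_repr_smul_pow_mem β σ hdet (hh.entry i a b) l (x i')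
    simpa [Finset.sum_apply] using this
  · simp only [Fintype.sum_prod_type]
    have h1 : ∀ i a b, ∑ l, β.repr (h j i a b) l • (Pi.single i (Matrix.single a b (β l)) :
        Fin t → Matrix (Fin n) (Fin n) T) = Pi.single i (Matrix.single a b (h j i a b)) := by
      intro i a b
      conv_rhs => rw [← β.sum_repr (h j i a b)]
      have := map_sum ((LinearMap.single R (fun _ : Fin t => Matrix (Fin n) (Fin n) T) i).comp
        (Matrix.singleLinearMap R a b : T →ₗ[R] _)) (fun l => β.repr (h j i a b) l • β l)
        Finset.univ
      simp only [map_smul] at this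
      exact this.symm
    simp only [h1]
    ext i r s
    simp only [Finset.sum_apply, Matrix.sum_apply]
    rw [Finset.sum_eq_single i (fun i' _ hi' => ?_) (by simp)]
    · rw [Finset.sum_eq_single r (fun a _ ha => ?_) (by simp),
        Finset.sum_eq_single s (fun b _ hb => ?_) (by simp)]
      · simp
      · simp [hb]
      · simp [ha]
    · simp [Pi.single_eq_of_ne' hi']

end NullSequences

/-! ### The structure of the completions gives central generators -/

section Backward

variable {D : Type u} [CommRing D] [IsDomain D] {P : Ideal D} [hP : P.IsMaximal] {π s : D}

/-- The unramified extensions of `K̂_P` have the properties of the standard model. -/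
theorem IsCompleteUnramified.exists_basis (h : IsLocalUniformizer P π s) (hfg : P.FG) (T : Type u)
    [CommRing T] [IsDomain T] [IsDiscreteValuationRing T] [Algebra (AdicCompletion P D) T]
    (hT : IsCompleteUnramified P T) :
    ∃ (d : ℕ) (b : Module.Basis (Fin d) (AdicCompletion P D) T)
      (σ : Fin d → T ≃ₐ[AdicCompletion P D] T), IsUnit (Matrix.of fun i j => σ i (b j)).det := by
  have hm : IsLocalRing.maximalIdeal T =
      Ideal.span {algebraMap (AdicCompletion P D) T (algebraMap D _ π)} := by
    rw [← hT.unramified, h.map_eq_span hfg, Ideal.map_span, Set.image_singleton]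
  have hc : PiComplete (algebraMap D (AdicCompletion P D) π) T := by
    rw [piComplete_iff_isAdicComplete, ← hm]
    exact hT.complete
  have hπ : algebraMap D (AdicCompletion P D) π ≠ 0 := fun h0 => by
    have h1 := h.noTorsion_base (P := P) 1 (by rw [h0, zero_smul])
    have : Nontrivial (AdicCompletion P D) := (algebraMap (AdicCompletion P D) T).domain_nontrivial
    exact one_ne_zero h1
  have hn : NoTorsion (algebraMap D (AdicCompletion P D) π) T := fun x hx => by
    rw [Algebra.smul_def] at hx
    refine (mul_eq_zero.1 hx).resolve_left fun h0 => hπ (hT.injective (by rw [h0, map_zero]))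
  have := hT.finite_residueField
  have hF : algebraMap (AdicCompletion P D) (IsLocalRing.ResidueField T) (algebraMap D _ π) = 0 := by
    rw [IsScalarTower.algebraMap_apply (AdicCompletion P D) T (IsLocalRing.ResidueField T)]
    refine (IsLocalRing.residue_eq_zero_iff _).2 ?_
    rw [hm]
    exact Ideal.mem_span_singleton_self _
  -- S is the standard model with the residue field of T; by rigidity S ≅ T, and the basis and
  -- automorphisms are transported.
  obtain ⟨S, _, _, _, _, d, b, ρ, σ, hS, -⟩ := exists_isModel_isCompleteUnramified h hfg _ hF
  have := hS.unramified
  have := Module.Free.of_basis b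
  have := Module.Finite.of_basis b
  obtain ⟨m, x, y, hxy⟩ := exists_isSeparability (AdicCompletion P D) S
  obtain ⟨ψ, -⟩ := exists_algEquiv_lift hc hn hS.complete hxy (IsLocalRing.residue T)
    IsLocalRing.residue_surjective (fun z => by
      rw [IsLocalRing.residue_eq_zero_iff, mem_powSub_self, ← hm, pow_one, smul_eq_mul,
        Ideal.mul_top]) ρ.toRingHom hS.surj hS.ker ρ.commutes
  refine ⟨d, b.map ψ.toLinearEquiv, fun i => ψ.symm.trans ((σ i).trans ψ), ?_⟩
  have : (Matrix.of fun i j => (ψ.symm.trans ((σ i).trans ψ)) (b.map ψ.toLinearEquiv j)) =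
      (Matrix.of fun i j => σ i (b j)).map ψ := by
    ext i j
    simp
  rw [this]
  have h2 := hS.det.map ψ.toRingEquiv.toRingHom
  rw [RingHom.map_det] at h2
  exact h2

open Polynomial in
/-- Null polynomials on `A` are generated by central ones if `Â_P` is a power of a matrix algebra
over an unramified extension. -/
theorem hasCentralNullGenerators_of_algEquiv (h : IsLocalUniformizer P π s) (hfg : P.FG)
    {A : Type v} [Ring A] [Algebra D A] [Module.IsTorsionFree D A] {n t : ℕ} {T : Type u}
    [CommRing T] [IsDomain T] [IsDiscreteValuationRing T] [Algebra (AdicCompletion P D) T]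
    (hT : IsCompleteUnramified P T)
    (e : Compl P A ≃ₐ[AdicCompletion P D] (Fin t → Matrix (Fin n) (Fin n) T)) :
    HasCentralNullGenerators P A := by
  intro k f hf
  obtain ⟨d, β, σ, hdet⟩ := hT.exists_basis h hfg
  set ϖ := algebraMap D (AdicCompletion P D) π with hϖ
  set N := f.natDegree + 1 with hN
  -- Being null modulo π^k extends from A to its completion because A is dense.
  have hnull : IsNullSeq ϖ k N fun j => e (toCompl P A (f.coeff j)) := by
    intro x
    obtain ⟨a, ha⟩ := h.exists_sub_toCompl_mem hfg k (e.symm x)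
    have h1 : ∑ j ∈ Finset.range N, toCompl P A (f.coeff j) * e.symm x ^ j ∈
        powSub ϖ k (Compl P A) := by
      have h2 : ∑ j ∈ Finset.range N, (toCompl P A (f.coeff j) * e.symm x ^ j -
          toCompl P A (f.coeff j) * toCompl P A a ^ j) ∈ powSub ϖ k (Compl P A) :=
        Submodule.sum_mem _ fun j _ => by
          rw [← mul_sub]
          exact mul_mem_powSub_left _ (pow_sub_pow_mem_powSub ha j)
      have h3 := (h.toCompl_mem_iff hfg k _).2 (hf a)
      rw [eval_eq_sum_range' (Nat.lt_succ_self _), map_sum] at h3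
      have h4 := add_mem h2 h3
      rw [← Finset.sum_add_distrib] at h4
      simpa using h4
    have h2 := map_mem_powSub e.toLinearMap h1
    simpa using h2
  obtain ⟨ι, _, r, c, hr, hc⟩ := hnull.exists_generators β σ hdet
  -- The generators are approximated modulo π^k by elements of D and A, which is all that is
  -- required.
  choose r' hr' using fun l j => h.exists_sub_mem_powSub hfg k (r l j)
  choose c' hc' using fun l => h.exists_sub_toCompl_mem hfg k (e.symm (c l))
  have hcoeff : ∀ l i, (∑ j ∈ Finset.range N, monomial j (r' l j) : D[X]).coeff i =
      if i < N then r' l i else 0 := fun l i => by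
    simp [finsetSum_coeff, coeff_monomial]
  refine ⟨ι, inferInstance, fun l => ∑ j ∈ Finset.range N, monomial j (r' l j), c', fun l a => ?_,
    fun i => ?_⟩
  · rw [← h.toCompl_mem_iff hfg k, map_sum, map_sum]
    have h1 := map_mem_powSub e.symm.toLinearMap (hr l (e (toCompl P A a)))
    have h2 : ∑ j ∈ Finset.range N, (r l j - algebraMap D _ (r' l j)) • toCompl P A a ^ j ∈
        powSub ϖ k (Compl P A) :=
      Submodule.sum_mem _ fun j _ => smul_mem_powSub_of_left (hr' l j) _
    have h3 := sub_mem h1 h2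
    convert h3 using 1
    rw [map_sum, ← Finset.sum_sub_distrib]
    refine Finset.sum_congr rfl fun j _ => ?_
    rw [aeval_monomial, ← Algebra.smul_def, toCompl_smul]
    simp [sub_smul]
  · simp only [hcoeff]
    split_ifs with hi
    · rw [← h.toCompl_mem_iff hfg k, map_sub, map_sum]
      have h1 : toCompl P A (f.coeff i) = ∑ l, r l i • e.symm (c l) := e.injective (by
        rw [hc, map_sum]
        simp)
      rw [h1, ← Finset.sum_sub_distrib]
      refine Submodule.sum_mem _ fun l _ => ?_
      have h2 : r l i • e.symm (c l) - toCompl P A (r' l i • c' l) =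
          (r l i - algebraMap D _ (r' l i)) • e.symm (c l) +
            algebraMap D (AdicCompletion P D) (r' l i) • (e.symm (c l) - toCompl P A (c' l)) := by
        rw [toCompl_smul, sub_smul, smul_sub]
        abel
      rw [h2]
      exact add_mem (smul_mem_powSub_of_left (hr' l i) _) (Submodule.smul_mem _ _ (hc' l))
    · rw [coeff_eq_zero_of_natDegree_lt (by omega)]
      simp

end Backward

/-! ### The commutative case -/

section Commutative

theorem eq_one_of_commute_matrix {t n : ℕ} (ht : 0 < t) (hn : 0 < n) {T : Type*} [CommRing T]
    [Nontrivial T]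
    (h : ∀ x y : Fin t → Matrix (Fin n) (Fin n) T, x * y = y * x) : n = 1 := by
  by_contra hne
  have hab : (⟨0, hn⟩ : Fin n) ≠ ⟨1, by omega⟩ := by simp
  have h1 := congrFun (congrFun (congrFun (h (fun _ => Matrix.single ⟨0, hn⟩ ⟨1, by omega⟩ 1)
    (fun _ => Matrix.single ⟨1, by omega⟩ ⟨0, hn⟩ 1)) ⟨0, ht⟩) ⟨0, hn⟩) ⟨0, hn⟩
  simp at h1

theorem compl_mul_comm {D : Type u} [CommRing D] (P : Ideal D) {A : Type v} [Ring A] [Algebra D A]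
    (hA : ∀ a b : A, a * b = b * a) (x y : Compl P A) : x * y = y * x :=
  Compl.ext fun k => by
    obtain ⟨a, ha⟩ := Ideal.Quotient.mk_surjective (evalCompl P A k x)
    obtain ⟨b, hb⟩ := Ideal.Quotient.mk_surjective (evalCompl P A k y)
    rw [map_mul, map_mul, ← ha, ← hb, ← map_mul, hA, map_mul]

/-- A power of `T` is a power of the algebra of `1 × 1` matrices over `T`. -/
def piMatrixOneEquiv (R : Type*) [CommRing R] (t : ℕ) (T : Type*) [CommRing T] [Algebra R T] :
    (Fin t → Matrix (Fin 1) (Fin 1) T) ≃ₐ[R] (Fin t → T) :=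
  AlgEquiv.piCongrRight fun _ =>
    { toFun x := x 0 0
      invFun r := Matrix.of fun _ _ => r
      left_inv x := by
        ext i j
        rw [Subsingleton.elim i 0, Subsingleton.elim j 0]
        rfl
      right_inv _ := rfl
      map_mul' x y := by simp [Matrix.mul_apply]
      map_add' _ _ := rfl
      commutes' r := by simp [Matrix.algebraMap_matrix_apply] }

end Commutative

end IntDecomp

/-! ### Assembly of the equivalence and its commutative form -/

theorem mainTheorem5 (D : Type u) [CommRing D] [IsDedekindDomain D]
    (hD : ∀ I : Ideal D, I ≠ ⊥ → Finite (D ⧸ I))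
    (K : Type w) [Field K] [Algebra D K] [IsFractionRing D K]
    (A : Type v) [Ring A] [Algebra D A] [Module.Finite D A]
    (hA : IntDecomp.StandardAssumptions D K A) :
    (IntDecomp.IsIntKDecomposable D K A ↔
      ∀ P : Ideal D, P.IsPrime → P ≠ ⊥ →
        ∃ (n t : ℕ) (T : Type u) (_ : CommRing T) (_ : IsDomain T) (_ : IsDiscreteValuationRing T)
          (_ : Algebra (AdicCompletion P D) T),
          0 < n ∧ 0 < t ∧ IntDecomp.IsCompleteUnramified P T ∧
          Nonempty (IntDecomp.Compl P A ≃ₐ[AdicCompletion P D]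
            (Fin t → Matrix (Fin n) (Fin n) T))) ∧
    ((∀ a b : A, a * b = b * a) →
      (IntDecomp.IsIntKDecomposable D K A ↔
        ∀ P : Ideal D, P.IsPrime → P ≠ ⊥ →
          ∃ (t : ℕ) (T : Type u) (_ : CommRing T) (_ : IsDomain T) (_ : IsDiscreteValuationRing T)
            (_ : Algebra (AdicCompletion P D) T),
            0 < t ∧ IntDecomp.IsCompleteUnramified P T ∧
            Nonempty (IntDecomp.Compl P A ≃ₐ[AdicCompletion P D] (Fin t → T)))) := by
  have := hA.torsionFree
  have main : IntDecomp.IsIntKDecomposable D K A ↔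
      ∀ P : Ideal D, P.IsPrime → P ≠ ⊥ →
        ∃ (n t : ℕ) (T : Type u) (_ : CommRing T) (_ : IsDomain T) (_ : IsDiscreteValuationRing T)
          (_ : Algebra (AdicCompletion P D) T),
          0 < n ∧ 0 < t ∧ IntDecomp.IsCompleteUnramified P T ∧
          Nonempty (IntDecomp.Compl P A ≃ₐ[AdicCompletion P D]
            (Fin t → Matrix (Fin n) (Fin n) T)) := by
    refine ⟨fun hdec P hP hP0 => ?_, fun h => ?_⟩
    · have := hD P hP0
      exact IntDecomp.exists_algEquiv_of_isIntKDecomposable hA hdec hP0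
    · refine IntDecomp.isIntKDecomposable_of_hasCentralNullGenerators fun P hP hP0 => ?_
      obtain ⟨n, t, T, _, _, _, _, -, -, hT, ⟨e⟩⟩ := h P hP.isPrime hP0
      have := hP.isPrime
      obtain ⟨π, s, hπ⟩ := IntDecomp.exists_isLocalUniformizer P hP0
      exact IntDecomp.hasCentralNullGenerators_of_algEquiv hπ (IsNoetherian.noetherian P) hT e
  refine ⟨main, fun hcomm => main.trans (forall_congr' fun P => forall_congr' fun hP =>
    forall_congr' fun hP0 => ⟨?_, ?_⟩)⟩
  · rintro ⟨n, t, T, _, _, _, _, hn, ht, hT, ⟨e⟩⟩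
    -- Commutativity of A passes to its completion, and matrix algebras commute only in size 1.
    obtain rfl := IntDecomp.eq_one_of_commute_matrix ht hn fun x y => e.symm.injective (by
      rw [map_mul, map_mul, IntDecomp.compl_mul_comm P hcomm])
    exact ⟨t, T, _, _, _, _, ht, hT, ⟨e.trans (IntDecomp.piMatrixOneEquiv _ t T)⟩⟩
  · rintro ⟨t, T, _, _, _, _, ht, hT, ⟨e⟩⟩
    exact ⟨1, t, T, _, _, _, _, one_pos, ht, hT,
      ⟨e.trans (IntDecomp.piMatrixOneEquiv _ t T).symm⟩⟩
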